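/- Let $n,m\in\mathbb N$, $A,A_1\in\mathbb R^{n\times n}$, $B,B_1\in\mathbb R^{n\times m}$, $\alpha\in(0,1)$, $Q\in\mathbb R^{n\times n}$ symmetric positive semidefinite and $R\in\mathbb R^{m\times m}$ symmetric positive definite, $W=Q\oplus R$. Consider the stochastic system $$x_{k+1}=Ax_k+Bu_k+(A_1x_k+B_1u_k)v_k+w_k,\qquad k\ge 0,$$ on a probability space, where $(w_k)$ is i.i.d. in $\mathbb R^n$ with mean $0$ and positive definite covariance matrix $\Sigma$, $(v_k)$ is i.i.d. in $\mathbb R$ with mean $0$ and variance $\sigma>0$, the sequences $(w_k)$ and $(v_k)$ are independent of each other, and $x_0$ is square integrable with positive definite covariance matrix and independent of $(w_k,v_k)_k$. Put $X_0=\mathbb E[x_0x_0^\top]$. Assume (i) the system is mean square stabilizable: there is $L\in\mathbb R^{m\times n}$ such that under $u_k=Lx_k$ the mean $\mathbb E[x_k]$ and the second moment $\mathbb E[x_kx_k^\top]$ converge as $k\to\infty$ to limits independent of $x_0$, for all initial states and noise sequences as above; (ii) $(A,A_1|\sqrt Q)$ is exactly detectable: whenever a trajectory of $x_{k+1}=Ax_k+A_1x_kv_k$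 with deterministic initial state satisfies $\sqrt Q\,x_k=0$ almost surely for all $k$, then $\mathbb E\|x_k\|^2\to 0$. For symmetric $F=\begin{bmatrix}F_{11}&F_{12}\\F_{12}^\top&F_{22}\end{bmatrix}\in\mathbb R^{(n+m)\times(n+m)}$ with $F_{22}\succ0$ let $\mathscr P(F)=F_{11}-F_{12}F_{22}^{-1}F_{12}^\top$, and for $X\succ0$ consider the dual problem $$\max_{F,M}\ \operatorname{Tr}(XM)\quad\text{s.t.}\quad F_{22}\succ0,\quad \mathscr P(F)-M\succeq0,$$ $$\alpha[A\ B]^\top\mathscr P(F)[A\ B]-F+W+\alpha\sigma[A_1\ B_1]^\top\mathscr P(F)[A_1\ B_1]\succeq0,$$ over symmetric $F\in\mathbb R^{(n+m)\times(n+m)}$ and $M\in\mathbb R^{n\times n}$. The case of interest is $X=X_0+\frac{\alpha}{1-\alpha}\Sigma$. Then the discounted generalized algebraic Riccati equation $$P=Q+\alpha A^\top PA+\alpha\sigma A_1^\top PA_1-\alpha^2(A^\top PB+\sigma A_1^\top PB_1)(R+\alpha B^\top PB+\alpha\sigma B_1^\top PB_1)^{-1}(B^\top PA+\sigma B_1^\top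 PA_1)$$ has exactly one positive semidefinite solution $P^*$. Let $$H^*=\begin{bmatrix}Q+\alpha A^\top P^*A+\alpha\sigma A_1^\top P^*A_1&\alpha A^\top P^*B+\alpha\sigma A_1^\top P^*B_1\\(\alpha A^\top P^*B+\alpha\sigma A_1^\top P^*B_1)^\top&R+\alpha B^\top P^*B+\alpha\sigma B_1^\top P^*B_1\end{bmatrix}$$ be the parameter matrix of the optimal Q-function. Then: 1. $(F^*,M^*)=(H^*,P^*)$ is an optimal point of the dual problem with $X=X_0+\frac{\alpha}{1-\alpha}\Sigma$. 2. Every optimal point $(F,M)$ of that problem satisfies $M=P^*$, $F\preceq H^*$ and $F_{22}^{-1}F_{12}^\top=(H^*_{22})^{-1}(H^*_{12})^\top$. 3. The optimal points do not depend on $X_0+\frac{\alpha}{1-\alpha}\Sigma$: for every positive definite $X\in\mathbb R^{n\times n}$ the dual problem with weight $X$ has the same set of optimal points. -/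

import Mathlib

open MeasureTheory ProbabilityTheory Filter Topology Matrix

universe u

noncomputable section

namespace StochLQR

/-- The second moment matrix `E[x xᵀ]` of a random vector. -/
def secondMoment {Ω : Type u} [MeasurableSpace Ω] (Pr : Measure Ω) {n : ℕ}
    (x : Ω → Fin n → ℝ) : Matrix (Fin n) (Fin n) ℝ :=
  Matrix.of fun i j => ∫ ω, x ω i * x ω j ∂Pr

/-- The covariance matrix of a random vector. -/
def covMatrix {Ω : Type u} [MeasurableSpace Ω] (Pr : Measure Ω) {n : ℕ}
    (x : Ω → Fin n → ℝ) : Matrix (Fin n) (Fin n) ℝ :=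
  Matrix.of fun i j => covariance (fun ω => x ω i) (fun ω => x ω j) Pr

/-- The additive noise `w` is i.i.d. with mean zero and positive definite covariance `Sig`, the
scalar multiplicative noise `v` is i.i.d. with mean zero and variance `σ > 0`, and the two
sequences are independent of each other. -/
structure IsNoise {Ω : Type u} [MeasurableSpace Ω] (Pr : Measure Ω) {n : ℕ} (σ : ℝ)
    (Sig : Matrix (Fin n) (Fin n) ℝ) (w : ℕ → Ω → Fin n → ℝ) (v : ℕ → Ω → ℝ) : Prop where
  w_measurable : ∀ k, Measurable (w k)
  w_memLp : ∀ k i, MemLp (fun ω => w k ω i) 2 Pr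
  w_indep : iIndepFun w Pr
  w_identDistrib : ∀ k, IdentDistrib (w k) (w 0) Pr Pr
  w_mean : ∀ k i, ∫ ω, w k ω i ∂Pr = 0
  w_cov : ∀ k, covMatrix Pr (w k) = Sig
  Sig_posDef : Sig.PosDef
  v_measurable : ∀ k, Measurable (v k)
  v_memLp : ∀ k, MemLp (v k) 2 Pr
  v_indep : iIndepFun v Pr
  v_identDistrib : ∀ k, IdentDistrib (v k) (v 0) Pr Pr
  v_mean : ∀ k, ∫ ω, v k ω ∂Pr = 0
  v_var : ∀ k, variance (v k) Pr = σ
  σ_pos : 0 < σ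
  w_v_indep : IndepFun (fun ω k => w k ω) (fun ω k => v k ω) Pr

/-- The initial state `x₀` is a square integrable random vector with positive definite covariance
matrix, independent of the noise sequence `(w, v)`. -/
structure IsInitialState {Ω : Type u} [MeasurableSpace Ω] (Pr : Measure Ω) {n : ℕ}
    (w : ℕ → Ω → Fin n → ℝ) (v : ℕ → Ω → ℝ) (x₀ : Ω → Fin n → ℝ) : Prop where
  measurable : Measurable x₀
  memLp : ∀ i, MemLp (fun ω => x₀ ω i) 2 Pr
  cov_posDef : (covMatrix Pr x₀).PosDef
  indep : IndepFun (fun ω k => (w k ω, v k ω)) x₀ Pr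

/-- The trajectory of `x_{k+1} = A x_k + (A₁ x_k) v_k + w_k` started at `x₀`. -/
def trajectory {Ω : Type u} {n : ℕ} (A A₁ : Matrix (Fin n) (Fin n) ℝ)
    (w : ℕ → Ω → Fin n → ℝ) (v : ℕ → Ω → ℝ) (x₀ : Ω → Fin n → ℝ) : ℕ → Ω → Fin n → ℝ
  | 0 => x₀
  | k + 1 => fun ω =>
      A *ᵥ trajectory A A₁ w v x₀ k ω + v k ω • (A₁ *ᵥ trajectory A A₁ w v x₀ k ω) + w k ω

/-- Mean square stability of `x_{k+1} = A x_k + (A₁ x_k) v_k + w_k`: for every admissible noise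
sequence the mean and the second moment matrix of the state converge, to limits that do not depend
on the initial state. -/
def IsMeanSquareStable {n : ℕ} (σ : ℝ) (Sig A A₁ : Matrix (Fin n) (Fin n) ℝ) : Prop :=
  ∀ (Ω : Type u) [MeasurableSpace Ω] (Pr : Measure Ω) [IsProbabilityMeasure Pr]
    (w : ℕ → Ω → Fin n → ℝ) (v : ℕ → Ω → ℝ), IsNoise Pr σ Sig w v →
    ∃ (μ : Fin n → ℝ) (X : Matrix (Fin n) (Fin n) ℝ),
      ∀ x₀ : Ω → Fin n → ℝ, IsInitialState Pr w v x₀ →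
        Tendsto (fun k => fun i => ∫ ω, trajectory A A₁ w v x₀ k ω i ∂Pr) atTop (𝓝 μ) ∧
        Tendsto (fun k => secondMoment Pr (trajectory A A₁ w v x₀ k)) atTop (𝓝 X)

/-- `L` is a (mean square) stabilizing gain: the closed loop under `u_k = L x_k` is mean square
stable. -/
def IsStabilizingGain {n m : ℕ} (σ : ℝ) (Sig A A₁ : Matrix (Fin n) (Fin n) ℝ)
    (B B₁ : Matrix (Fin n) (Fin m) ℝ) (L : Matrix (Fin m) (Fin n) ℝ) : Prop :=
  IsMeanSquareStable.{u} σ Sig (A + B * L) (A₁ + B₁ * L)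

/-- Exact detectability of `(A, A₁ | C)`: whenever the output `y_k = C x_k` of the system
`x_{k+1} = A x_k + (A₁ x_k) v_k`, started at a point of `ℝⁿ`, vanishes almost surely at all times,
the state tends to zero in mean square. -/
def IsExactlyDetectable {Ω : Type u} [MeasurableSpace Ω] (Pr : Measure Ω) {n : ℕ}
    (v : ℕ → Ω → ℝ) (A A₁ C : Matrix (Fin n) (Fin n) ℝ) : Prop :=
  ∀ ξ : Fin n → ℝ,
    (∀ k, ∀ᵐ ω ∂Pr, C *ᵥ trajectory A A₁ (fun _ _ => 0) v (fun _ => ξ) k ω = 0) →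
    Tendsto (fun k => ∫ ω, ∑ i, (trajectory A A₁ (fun _ _ => 0) v (fun _ => ξ) k ω i) ^ 2 ∂Pr)
      atTop (𝓝 0)

/-- The right-hand side of the discounted generalized algebraic Riccati equation. -/
def riccati {n m : ℕ} (α σ : ℝ) (A A₁ : Matrix (Fin n) (Fin n) ℝ) (B B₁ : Matrix (Fin n) (Fin m) ℝ)
    (Q : Matrix (Fin n) (Fin n) ℝ) (R : Matrix (Fin m) (Fin m) ℝ)
    (P : Matrix (Fin n) (Fin n) ℝ) : Matrix (Fin n) (Fin n) ℝ :=
  Q + α • (Aᵀ * P * A) + (α * σ) • (A₁ᵀ * P * A₁)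
    - α ^ 2 • ((Aᵀ * P * B + σ • (A₁ᵀ * P * B₁))
        * (R + α • (Bᵀ * P * B) + (α * σ) • (B₁ᵀ * P * B₁))⁻¹
        * (Bᵀ * P * A + σ • (B₁ᵀ * P * A₁)))

/-- `P` is a positive semidefinite solution of the Riccati equation `P = ℛ(P)`. -/
def IsRiccatiSolution {n m : ℕ} (α σ : ℝ) (A A₁ : Matrix (Fin n) (Fin n) ℝ)
    (B B₁ : Matrix (Fin n) (Fin m) ℝ) (Q : Matrix (Fin n) (Fin n) ℝ)
    (R : Matrix (Fin m) (Fin m) ℝ) (P : Matrix (Fin n) (Fin n) ℝ) : Prop :=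
  P.PosSemidef ∧ P = riccati α σ A A₁ B B₁ Q R P

/-- The parameter matrix `H` of the Q-function that belongs to the value matrix `P`. -/
def qParam {n m : ℕ} (α σ : ℝ) (A A₁ : Matrix (Fin n) (Fin n) ℝ) (B B₁ : Matrix (Fin n) (Fin m) ℝ)
    (Q : Matrix (Fin n) (Fin n) ℝ) (R : Matrix (Fin m) (Fin m) ℝ)
    (P : Matrix (Fin n) (Fin n) ℝ) : Matrix (Fin n ⊕ Fin m) (Fin n ⊕ Fin m) ℝ :=
  Matrix.fromBlocks
    (Q + α • (Aᵀ * P * A) + (α * σ) • (A₁ᵀ * P * A₁))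
    (α • (Aᵀ * P * B) + (α * σ) • (A₁ᵀ * P * B₁))
    (α • (Aᵀ * P * B) + (α * σ) • (A₁ᵀ * P * B₁))ᵀ
    (R + α • (Bᵀ * P * B) + (α * σ) • (B₁ᵀ * P * B₁))

/-- `𝒫(F) = F₁₁ - F₁₂ F₂₂⁻¹ F₁₂ᵀ`. -/
def schur {n m : ℕ} (F : Matrix (Fin n ⊕ Fin m) (Fin n ⊕ Fin m) ℝ) : Matrix (Fin n) (Fin n) ℝ :=
  F.toBlocks₁₁ - F.toBlocks₁₂ * F.toBlocks₂₂⁻¹ * F.toBlocks₁₂ᵀ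

/-- The constraints of the dual problem; `W = Q ⊕ R`. -/
structure IsDualFeasible {n m : ℕ} (α σ : ℝ) (A A₁ : Matrix (Fin n) (Fin n) ℝ)
    (B B₁ : Matrix (Fin n) (Fin m) ℝ) (Q : Matrix (Fin n) (Fin n) ℝ) (R : Matrix (Fin m) (Fin m) ℝ)
    (F : Matrix (Fin n ⊕ Fin m) (Fin n ⊕ Fin m) ℝ) (M : Matrix (Fin n) (Fin n) ℝ) : Prop where
  symm : F.IsSymm
  posDef : F.toBlocks₂₂.PosDef
  schur_sub : (schur F - M).PosSemidef
  lmi : (α • ((Matrix.fromCols A B)ᵀ * schur F * Matrix.fromCols A B) - F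
      + Matrix.fromBlocks Q 0 0 R
      + (α * σ) • ((Matrix.fromCols A₁ B₁)ᵀ * schur F * Matrix.fromCols A₁ B₁)).PosSemidef

/-- `(F, M)` is an optimal point of the dual problem: it is feasible and maximizes `Tr(X M)` over
all feasible points. -/
def IsDualOptimal {n m : ℕ} (α σ : ℝ) (A A₁ : Matrix (Fin n) (Fin n) ℝ)
    (B B₁ : Matrix (Fin n) (Fin m) ℝ) (Q : Matrix (Fin n) (Fin n) ℝ) (R : Matrix (Fin m) (Fin m) ℝ)
    (X : Matrix (Fin n) (Fin n) ℝ)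
    (F : Matrix (Fin n ⊕ Fin m) (Fin n ⊕ Fin m) ℝ) (M : Matrix (Fin n) (Fin n) ℝ) : Prop :=
  IsDualFeasible α σ A A₁ B B₁ Q R F M ∧
    ∀ F' M', IsDualFeasible α σ A A₁ B B₁ Q R F' M' → (X * M').trace ≤ (X * M).trace

end StochLQR

end

open scoped MatrixOrder

/-! The probability enters only through second moments. Since `x_k` is independent of `(w_k, v_k)`,
the moment matrix evolves by the affine recursion `X ↦ lyap 1 σ Aᵀ A₁ᵀ X + Sig`, and `lyap` with
transposed arguments is the trace adjoint of the operator acting on value matrices. The rest is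
order theory of positive operators on symmetric matrices.

Stability is encoded by a strict supersolution: `Y ≻ 0` with `Y - lyap Y ≻ 0`. By convex separation
(`lyap_alternative`) it exists unless some nonzero `X ⪰ 0` satisfies `X ⪯ lyap* X`. Stabilizability
excludes such an `X` for some gain, and a multiple of the resulting `Y` bounds value iteration from
`0`, which increases to a solution `P`. Detectability excludes such an `X` for the gain of any
solution (`exists_lyap_of_solution`): an `X` of this kind incurs no cost, hence receives no control,
and must decay along the open loop although it is a lower bound there.

Under a stable closed loop, `lyap D ⪯ D` forces `D ⪰ 0` (`nonneg_of_lyap_le`). So every subsolution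
of the Riccati equation lies below `P` (`le_of_isRiccatiSolution`). This gives uniqueness, and `M ⪯
schur F ⪯ P` at every feasible point. The dual problem therefore has a greatest feasible `M`, which
is the unique maximizer of `Tr(XM)` whatever `X ≻ 0` is. -/

namespace StochLQR

/-! ### Loewner order on real matrices -/

section Order

variable {n m : ℕ}

theorem posSemidef_iff_quadForm {ι : Type*} [Fintype ι] {M : Matrix ι ι ℝ} :
    M.PosSemidef ↔ Mᵀ = M ∧ ∀ x, 0 ≤ x ⬝ᵥ M *ᵥ x := by
  rw [posSemidef_iff_dotProduct_mulVec, IsHermitian, conjTranspose_eq_transpose_of_trivial]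
  simp only [star_trivial]

theorem conj_nonneg {ι κ : Type*} [Fintype ι] [Fintype κ] {P : Matrix ι ι ℝ} (hP : 0 ≤ P)
    (G : Matrix ι κ ℝ) : 0 ≤ Gᵀ * P * G := by
  rw [nonneg_iff_posSemidef] at *
  simpa [conjTranspose_eq_transpose_of_trivial] using hP.conjTranspose_mul_mul_same G

theorem conj_mono {ι κ : Type*} [Fintype ι] [Fintype κ] {P P' : Matrix ι ι ℝ} (h : P ≤ P')
    (G : Matrix ι κ ℝ) : Gᵀ * P * G ≤ Gᵀ * P' * G := by
  have := conj_nonneg (sub_nonneg.2 h) G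
  rw [Matrix.mul_sub, Matrix.sub_mul] at this
  exact sub_nonneg.1 this

theorem trace_mul_nonneg {ι : Type*} [Fintype ι] [DecidableEq ι] {P X : Matrix ι ι ℝ}
    (hP : 0 ≤ P) (hX : 0 ≤ X) : 0 ≤ (P * X).trace := by
  obtain ⟨b, rfl⟩ := CStarAlgebra.nonneg_iff_eq_star_mul_self.1 hX
  rw [star_eq_conjTranspose, conjTranspose_eq_transpose_of_trivial, ← Matrix.mul_assoc,
    Matrix.trace_mul_comm, ← Matrix.mul_assoc]
  have := conj_nonneg hP bᵀ
  rw [transpose_transpose] at this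
  exact (nonneg_iff_posSemidef.1 this).trace_nonneg

theorem transpose_eq_of_nonneg {ι : Type*} [Fintype ι] {P : Matrix ι ι ℝ} (hP : 0 ≤ P) : Pᵀ = P :=
  (posSemidef_iff_quadForm.1 (nonneg_iff_posSemidef.1 hP)).1

/-- A positive semidefinite matrix is orthogonal to another one only if their product vanishes. -/
theorem mul_eq_zero_of_trace_eq_zero {ι : Type*} [Fintype ι] [DecidableEq ι] {P X : Matrix ι ι ℝ}
    (hP : 0 ≤ P) (hX : 0 ≤ X) (h : (P * X).trace = 0) : P * X = 0 := by
  obtain ⟨c, rfl⟩ := CStarAlgebra.nonneg_iff_eq_star_mul_self.1 hP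
  obtain ⟨b, rfl⟩ := CStarAlgebra.nonneg_iff_eq_star_mul_self.1 hX
  simp only [star_eq_conjTranspose] at *
  have : ((c * bᴴ)ᴴ * (c * bᴴ)).trace = 0 := by
    rw [← h, conjTranspose_mul, conjTranspose_conjTranspose, Matrix.mul_assoc,
      Matrix.trace_mul_comm b]
    simp only [Matrix.mul_assoc]
  have h0 := trace_conjTranspose_mul_self_eq_zero_iff.1 this
  calc cᴴ * c * (bᴴ * b) = cᴴ * (c * bᴴ) * b := by simp only [Matrix.mul_assoc]
    _ = 0 := by rw [h0]; simp

theorem exists_smul_one_le {Z : Matrix (Fin n) (Fin n) ℝ} (hZ : Z.PosDef) :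
    ∃ c : ℝ, 0 < c ∧ c • (1 : Matrix (Fin n) (Fin n) ℝ) ≤ Z := by
  rcases n.eq_zero_or_pos with rfl | hn
  · exact ⟨1, one_pos, le_of_eq (Subsingleton.elim _ _)⟩
  · have : Nonempty (Fin n) := ⟨⟨0, hn⟩⟩
    have hs := isStrictlyPositive_iff_posDef.2 hZ
    obtain ⟨r, hr, h⟩ := (CFC.exists_pos_algebraMap_le_iff (a := Z) hZ.1).2
      fun x hx => hs.spectrum_pos hx
    exact ⟨r, hr, by rwa [Algebra.algebraMap_eq_smul_one] at h⟩

theorem exists_le_smul_one {Z : Matrix (Fin n) (Fin n) ℝ} (hZ : Zᵀ = Z) :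
    ∃ c : ℝ, 0 < c ∧ Z ≤ c • (1 : Matrix (Fin n) (Fin n) ℝ) := by
  have hsa : IsSelfAdjoint Z := by
    rw [IsSelfAdjoint, star_eq_conjTranspose, conjTranspose_eq_transpose_of_trivial, hZ]
  obtain ⟨B, hB⟩ := (ContinuousFunctionalCalculus.isCompact_spectrum (R := ℝ) Z).bddAbove
  refine ⟨max B 1, by positivity, ?_⟩
  rw [← Algebra.algebraMap_eq_smul_one, le_algebraMap_iff_spectrum_le hsa]
  exact fun x hx => (hB hx).trans (le_max_left _ _)

theorem posDef_of_le {ι : Type*} [Fintype ι] {Z Z' : Matrix ι ι ℝ}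
    (hZ : Z.PosDef) (h : Z ≤ Z') : Z'.PosDef := by
  have := hZ.add_posSemidef (le_iff.1 h)
  rwa [add_sub_cancel] at this

theorem exists_smul_le {Z D : Matrix (Fin n) (Fin n) ℝ} (hZ : Z.PosDef) (hD : Dᵀ = D) :
    ∃ c : ℝ, 0 < c ∧ D ≤ c • Z := by
  obtain ⟨a, ha, h1⟩ := exists_smul_one_le hZ
  obtain ⟨b, hb, h2⟩ := exists_le_smul_one hD
  refine ⟨b / a, by positivity, h2.trans ?_⟩
  calc b • (1 : Matrix (Fin n) (Fin n) ℝ) = (b / a) • (a • 1) := by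
        rw [smul_smul, div_mul_cancel₀ _ ha.ne']
    _ ≤ (b / a) • Z := smul_le_smul_of_nonneg_left h1 (by positivity)

theorem le_iff_quadForm {ι : Type*} [Fintype ι] {P P' : Matrix ι ι ℝ} (h : Pᵀ = P) (h' : P'ᵀ = P') :
    P ≤ P' ↔ ∀ x, x ⬝ᵥ P *ᵥ x ≤ x ⬝ᵥ P' *ᵥ x := by
  rw [le_iff, posSemidef_iff_quadForm]
  simp [h, h', sub_mulVec, dotProduct_sub]

theorem quadForm_mono {ι : Type*} [Fintype ι] {P P' : Matrix ι ι ℝ} (h : P ≤ P') (x : ι → ℝ) :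
    x ⬝ᵥ P *ᵥ x ≤ x ⬝ᵥ P' *ᵥ x := by
  have := (posSemidef_iff_quadForm.1 (le_iff.1 h)).2 x
  simpa [sub_mulVec, dotProduct_sub] using this

theorem quadForm_eq_trace {ι : Type*} [Fintype ι] (P : Matrix ι ι ℝ) (x : ι → ℝ) :
    x ⬝ᵥ P *ᵥ x = (P * vecMulVec x x).trace := by
  rw [mul_vecMulVec, trace_vecMulVec, dotProduct_comm]

theorem vecMulVec_nonneg {ι : Type*} [Fintype ι] (x : ι → ℝ) : 0 ≤ vecMulVec x x := by
  rw [nonneg_iff_posSemidef]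
  simpa using posSemidef_vecMulVec_self_star x

/-- With `X = bᵀb`, the rows of `b` serve as the vectors. This reduces general moment matrices to
deterministic initial states, the only ones that exact detectability speaks of. -/
theorem exists_eq_sum_vecMulVec {X : Matrix (Fin n) (Fin n) ℝ} (hX : 0 ≤ X) :
    ∃ ξ : Fin n → Fin n → ℝ, X = ∑ i, vecMulVec (ξ i) (ξ i) := by
  obtain ⟨b, rfl⟩ := CStarAlgebra.nonneg_iff_eq_star_mul_self.1 hX
  refine ⟨b, ?_⟩
  ext i j
  simp [Matrix.mul_apply, Matrix.sum_apply, vecMulVec_apply]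

end Order

/-! ### Lyapunov operators and comparison -/

section Lyapunov

variable {n : ℕ}

/-- The Lyapunov operator `P ↦ a GᵀPG + b HᵀPH`. -/
noncomputable def lyap (a b : ℝ) (G H : Matrix (Fin n) (Fin n) ℝ) :
    Matrix (Fin n) (Fin n) ℝ →ₗ[ℝ] Matrix (Fin n) (Fin n) ℝ where
  toFun P := a • (Gᵀ * P * G) + b • (Hᵀ * P * H)
  map_add' P P' := by simp only [Matrix.mul_add, Matrix.add_mul, smul_add]; abel
  map_smul' c P := by
    simp only [Matrix.mul_smul, Matrix.smul_mul, smul_add, RingHom.id_apply, smul_comm c]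

theorem lyap_apply (a b : ℝ) (G H P : Matrix (Fin n) (Fin n) ℝ) :
    lyap a b G H P = a • (Gᵀ * P * G) + b • (Hᵀ * P * H) := rfl

variable {a b : ℝ} {G H : Matrix (Fin n) (Fin n) ℝ}

theorem lyap_nonneg (ha : 0 ≤ a) (hb : 0 ≤ b) {P : Matrix (Fin n) (Fin n) ℝ} (hP : 0 ≤ P) :
    0 ≤ lyap a b G H P :=
  add_nonneg (smul_nonneg ha (conj_nonneg hP G)) (smul_nonneg hb (conj_nonneg hP H))

theorem lyap_mono (ha : 0 ≤ a) (hb : 0 ≤ b) {P P' : Matrix (Fin n) (Fin n) ℝ} (h : P ≤ P') :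
    lyap a b G H P ≤ lyap a b G H P' := by
  have := lyap_nonneg (G := G) (H := H) ha hb (sub_nonneg.2 h)
  rwa [map_sub, sub_nonneg] at this

theorem lyap_transpose (P : Matrix (Fin n) (Fin n) ℝ) :
    (lyap a b G H P)ᵀ = lyap a b G H Pᵀ := by
  simp [lyap_apply, transpose_mul, Matrix.mul_assoc]

theorem trace_mul_lyap (P X : Matrix (Fin n) (Fin n) ℝ) :
    (P * lyap a b Gᵀ Hᵀ X).trace = (lyap a b G H P * X).trace := by
  have key (K : Matrix (Fin n) (Fin n) ℝ) : (P * (K * X * Kᵀ)).trace = (Kᵀ * P * K * X).trace := by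
    rw [← Matrix.mul_assoc, Matrix.trace_mul_comm]
    simp only [Matrix.mul_assoc]
  simp only [lyap_apply, Matrix.mul_add, Matrix.add_mul, trace_add, Matrix.mul_smul,
    Matrix.smul_mul, trace_smul, transpose_transpose, key]

/-- Positivity of supersolutions of a stable Lyapunov operator. -/
theorem nonneg_of_lyap_le (ha : 0 ≤ a) (hb : 0 ≤ b) {Y D : Matrix (Fin n) (Fin n) ℝ}
    (hY : Y.PosDef) (hYs : (Y - lyap a b G H Y).PosDef) (hD : lyap a b G H D ≤ D)
    (hDs : Dᵀ = D) : 0 ≤ D := by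
  have hYt := transpose_eq_of_nonneg (nonneg_iff_posSemidef.2 hY.posSemidef)
  have hY0 : 0 ≤ Y := nonneg_iff_posSemidef.2 hY.posSemidef
  obtain ⟨e, he, h1⟩ := exists_smul_le hYs hYt
  obtain ⟨c, hc, h2⟩ := exists_smul_le (D := -D) hY (by simp [hDs])
  -- From `Y ≤ e • (Y - lyap Y)` follows `lyap Y ≤ (1 - e⁻¹) • Y`; the minimum with `1` keeps the
  -- contraction factor nonnegative.
  have h3 : lyap a b G H Y ≤ (1 - min e⁻¹ 1) • Y := by
    have h4 : (min e⁻¹ 1) • Y ≤ e⁻¹ • (e • (Y - lyap a b G H Y)) :=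
      (smul_le_smul_of_nonneg_right (min_le_left _ _)
        hY0).trans
        (smul_le_smul_of_nonneg_left h1 (by positivity))
    rw [smul_smul, inv_mul_cancel₀ he.ne', one_smul] at h4
    rw [sub_smul, one_smul]
    exact le_sub_comm.1 h4
  set r := 1 - min e⁻¹ 1
  have hr0 : 0 ≤ r := sub_nonneg.2 (min_le_right _ _)
  have hr1 : r < 1 := sub_lt_self _ (by positivity)
  -- If `-(c r^k) Y ≤ D`, applying `lyap` gives `D ≥ lyap D ≥ -(c r^k) lyap Y ≥ -(c r^(k+1)) Y`; the
  -- lower bound shrinks to zero.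
  have key : ∀ k : ℕ, 0 ≤ D + (c * r ^ k) • Y := by
    intro k
    induction k with
    | zero => simpa using neg_le_iff_add_nonneg'.1 h2
    | succ k ih =>
      have h5 := lyap_nonneg (G := G) (H := H) ha hb ih
      rw [map_add, map_smul] at h5
      refine h5.trans (add_le_add hD ?_)
      rw [pow_succ, ← mul_assoc, mul_smul _ r]
      exact smul_le_smul_of_nonneg_left h3 (mul_nonneg hc.le (pow_nonneg hr0 k))
  rw [nonneg_iff_posSemidef, posSemidef_iff_quadForm]
  refine ⟨hDs, fun x => ?_⟩
  have hlim : Tendsto (fun k : ℕ => x ⬝ᵥ D *ᵥ x + (c * r ^ k) * (x ⬝ᵥ Y *ᵥ x)) atTop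
      (𝓝 (x ⬝ᵥ D *ᵥ x + (c * 0) * (x ⬝ᵥ Y *ᵥ x))) :=
    tendsto_const_nhds.add (((tendsto_pow_atTop_nhds_zero_of_lt_one hr0 hr1).const_mul c).mul_const _)
  rw [mul_zero, zero_mul, add_zero] at hlim
  refine ge_of_tendsto' hlim fun k => ?_
  have := (posSemidef_iff_quadForm.1 (nonneg_iff_posSemidef.1 (key k))).2 x
  simpa [add_mulVec, smul_mulVec, dotProduct_add, dotProduct_smul] using this

end Lyapunov

/-! ### Theorem of the alternative by convex separation -/

section Alternative

variable {n : ℕ}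

theorem posDef_of_quadForm_pos {ι : Type*} [Fintype ι] {M : Matrix ι ι ℝ} (hM : Mᵀ = M)
    (h : ∀ x, x ≠ 0 → 0 < x ⬝ᵥ M *ᵥ x) : M.PosDef := by
  refine PosDef.of_dotProduct_mulVec_pos ?_ fun {x} hx => by simpa using h x hx
  rw [IsHermitian, conjTranspose_eq_transpose_of_trivial, hM]

/-- Matrices close to the identity have positive definite symmetric part. -/
theorem posDef_add_transpose_of_near_one {Z : Matrix (Fin n) (Fin n) ℝ}
    (h : ∀ i j, |(Z - 1) i j| ≤ ((n : ℝ) + 1)⁻¹) : (Z + Zᵀ).PosDef := by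
  refine posDef_of_quadForm_pos (by simp [add_comm]) fun x hx => ?_
  have e1 : x ⬝ᵥ (Z + Zᵀ) *ᵥ x = 2 * (x ⬝ᵥ x + x ⬝ᵥ (Z - 1) *ᵥ x) := by
    rw [add_mulVec, dotProduct_add, sub_mulVec, dotProduct_sub, one_mulVec, mulVec_transpose,
      dotProduct_comm x (x ᵥ* Z), ← dotProduct_mulVec]
    ring
  have hpos : 0 < x ⬝ᵥ x := by simpa using dotProduct_star_self_pos_iff.2 hx
  -- By Cauchy–Schwarz the perturbation is at most `n / (n + 1)` times `x ⬝ᵥ x`, hence the radius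
  -- `(n + 1)⁻¹`.
  have e2 : |x ⬝ᵥ (Z - 1) *ᵥ x| ≤ ((n : ℝ) + 1)⁻¹ * (n * (x ⬝ᵥ x)) := by
    calc |x ⬝ᵥ (Z - 1) *ᵥ x| = |∑ i, ∑ j, x i * ((Z - 1) i j * x j)| := by
          simp only [dotProduct, mulVec, Finset.mul_sum]
      _ ≤ ∑ i, ∑ j, |x i| * (((n : ℝ) + 1)⁻¹ * |x j|) := by
          refine (Finset.abs_sum_le_sum_abs _ _).trans (Finset.sum_le_sum fun i _ => ?_)
          refine (Finset.abs_sum_le_sum_abs _ _).trans (Finset.sum_le_sum fun j _ => ?_)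
          rw [abs_mul, abs_mul]
          gcongr
          exact h i j
      _ = ((n : ℝ) + 1)⁻¹ * (∑ i, |x i|) ^ 2 := by
          rw [sq, Finset.sum_mul_sum, Finset.mul_sum]
          refine Finset.sum_congr rfl fun i _ => ?_
          rw [Finset.mul_sum]
          exact Finset.sum_congr rfl fun j _ => by ring
      _ ≤ ((n : ℝ) + 1)⁻¹ * (n * (x ⬝ᵥ x)) := by
          gcongr
          have := sq_sum_le_card_mul_sum_sq (s := Finset.univ) (f := fun i => |x i|)
          simpa [dotProduct, sq] using this
  have e3 : ((n : ℝ) + 1)⁻¹ * (n * (x ⬝ᵥ x)) < x ⬝ᵥ x := by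
    rw [inv_mul_lt_iff₀ (by positivity)]
    linarith
  rw [e1]
  have := neg_abs_le (x ⬝ᵥ (Z - 1) *ᵥ x)
  linarith

/-- A theorem of the alternative for Lyapunov operators: either the operator has a strict positive
definite supersolution, or its adjoint has a nonzero positive semidefinite subsolution. -/
theorem lyap_alternative {a b : ℝ} (ha : 0 ≤ a) (hb : 0 ≤ b) (G H : Matrix (Fin n) (Fin n) ℝ)
    (hX : ∀ X : Matrix (Fin n) (Fin n) ℝ, 0 ≤ X → X ≤ lyap a b Gᵀ Hᵀ X → X = 0) :
    ∃ Y : Matrix (Fin n) (Fin n) ℝ, Y.PosDef ∧ (Y - lyap a b G H Y).PosDef := by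
  by_contra! hno
  set δ := ((n : ℝ) + 1)⁻¹ with hδ
  have hδ0 : 0 < δ := by positivity
  -- Separation takes place in the space of all matrices, so `t` constrains only the symmetric part
  -- `Z + Zᵀ`. The box `s` around the identity is open and convex, and `t` is a convex cone.
  let s : Set (Matrix (Fin n) (Fin n) ℝ) := Set.pi Set.univ fun i => Set.pi Set.univ fun j =>
    Set.Ioo ((1 : Matrix (Fin n) (Fin n) ℝ) i j - δ) ((1 : Matrix (Fin n) (Fin n) ℝ) i j + δ)
  let t : Set (Matrix (Fin n) (Fin n) ℝ) := {Z | ∃ Y, 0 ≤ Y ∧ Z + Zᵀ ≤ Y - lyap a b G H Y}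
  have hs_conv : Convex ℝ s := convex_pi fun i _ => convex_pi fun j _ => convex_Ioo _ _
  have hs_open : IsOpen s := isOpen_set_pi Set.finite_univ fun i _ =>
    isOpen_set_pi Set.finite_univ fun j _ => isOpen_Ioo
  have ht_conv : Convex ℝ t := by
    rintro Z ⟨Y, hY, hZ⟩ Z' ⟨Y', hY', hZ'⟩ c d hc hd -
    refine ⟨c • Y + d • Y', add_nonneg (smul_nonneg hc hY) (smul_nonneg hd hY'), ?_⟩
    have := add_le_add (smul_le_smul_of_nonneg_left hZ hc) (smul_le_smul_of_nonneg_left hZ' hd)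
    convert this using 1
    · simp only [transpose_add, transpose_smul, smul_add]; abel
    · simp only [map_add, map_smul, smul_sub]; abel
  have hdisj : Disjoint s t := by
    rw [Set.disjoint_left]
    rintro Z hZ ⟨Y, hY, hZY⟩
    have h1 : (Z + Zᵀ).PosDef := by
      refine posDef_add_transpose_of_near_one fun i j => ?_
      have := hZ i (Set.mem_univ i) j (Set.mem_univ j)
      rw [Matrix.sub_apply, abs_le]
      constructor <;> linarith [this.1, this.2]
    have h2 := posDef_of_le h1 hZY
    -- Members of `t` only have `Y ≥ 0`, but `Y ≥ Y - lyap Y ≥ Z + Zᵀ ≻ 0` makes `Y` positive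
    -- definite.
    refine hno Y (posDef_of_le h2 ?_) h2
    exact sub_le_self _ (lyap_nonneg ha hb hY)
  obtain ⟨f, u, hfs, hft⟩ := geometric_hahn_banach_open hs_conv hs_open ht_conv hdisj
  have hu : u ≤ 0 := by
    have := hft 0 ⟨0, le_rfl, by simp⟩
    simpa using this
  have h1 : f 1 < 0 := lt_of_lt_of_le (hfs 1 fun i _ j _ => ⟨by linarith, by linarith⟩) hu
  -- A functional bounded below on a cone is nonnegative there.
  have hcone : ∀ Z ∈ t, 0 ≤ f Z := by
    rintro Z ⟨Y, hY, hZ⟩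
    by_contra! hneg
    obtain ⟨c, hc⟩ := exists_nat_gt (u / f Z)
    have hmem : (c : ℝ) • Z ∈ t := by
      refine ⟨(c : ℝ) • Y, smul_nonneg (by positivity) hY, ?_⟩
      have := smul_le_smul_of_nonneg_left hZ (Nat.cast_nonneg (α := ℝ) c)
      convert this using 1
      · simp only [transpose_smul, smul_add]
      · simp only [map_smul, smul_sub]
    have h2 := hft _ hmem
    rw [map_smul, smul_eq_mul] at h2
    rw [div_lt_iff_of_neg hneg] at hc
    linarith
  -- `X` represents minus the symmetrized functional under the trace pairing; the sign turns `f 1 <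
  -- 0` into positive trace.
  let X : Matrix (Fin n) (Fin n) ℝ :=
    Matrix.of fun i j => -(f (Matrix.single i j 1) + f (Matrix.single j i 1))
  have htr : ∀ Z : Matrix (Fin n) (Fin n) ℝ, (Z * X).trace = -(f Z + f Zᵀ) := by
    intro Z
    have e : ∀ Z : Matrix (Fin n) (Fin n) ℝ, f Z = ∑ i, ∑ j, Z i j * f (Matrix.single i j 1) := by
      intro Z
      conv_lhs => rw [matrix_eq_sum_single Z]
      simp only [map_sum]
      refine Finset.sum_congr rfl fun i _ => Finset.sum_congr rfl fun j _ => ?_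
      rw [← smul_eq_mul (Z i j), ← map_smul, smul_single, smul_eq_mul, mul_one]
    rw [e Z, e Zᵀ]
    simp only [transpose_apply]
    rw [Finset.sum_comm (f := fun i j => Z j i * f (Matrix.single i j 1))]
    simp only [Matrix.trace, Matrix.diag, Matrix.mul_apply, X, Matrix.of_apply,
      ← Finset.sum_add_distrib, ← Finset.sum_neg_distrib]
    refine Finset.sum_congr rfl fun i _ => Finset.sum_congr rfl fun j _ => ?_
    ring
  have hXt : Xᵀ = X := by
    ext i j
    simp [X, add_comm]
  have hX0 : 0 ≤ X := by
    rw [nonneg_iff_posSemidef, posSemidef_iff_quadForm]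
    refine ⟨hXt, fun x => ?_⟩
    rw [quadForm_eq_trace, Matrix.trace_mul_comm, htr, transpose_vecMulVec]
    have := hcone (-vecMulVec x x) ⟨0, le_rfl, by
      have := vecMulVec_nonneg x
      rw [transpose_neg, transpose_vecMulVec, map_zero, sub_zero, ← neg_add]
      exact neg_nonpos.2 (add_nonneg this this)⟩
    rw [map_neg] at this
    linarith
  have hXle : X ≤ lyap a b Gᵀ Hᵀ X := by
    rw [le_iff_quadForm hXt (by rw [lyap_transpose, hXt])]
    intro x
    set V := vecMulVec x x with hV
    have hVt : Vᵀ = V := transpose_vecMulVec x x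
    rw [quadForm_eq_trace, quadForm_eq_trace, Matrix.trace_mul_comm, Matrix.trace_mul_comm _ V,
      trace_mul_lyap, htr, htr, lyap_transpose, hVt]
    -- The factor `2` in the witness matches `Z + Zᵀ = 2Z` for the symmetric `Z = V - lyap V`.
    have := hcone (V - lyap a b G H V) ⟨(2 : ℝ) • V, smul_nonneg zero_le_two (vecMulVec_nonneg x), by
      rw [transpose_sub, lyap_transpose, hVt, map_smul, two_smul, two_smul]
      exact le_of_eq (by abel)⟩
    rw [map_sub] at this
    linarith
  have := htr 1
  rw [hX X hX0 hXle, transpose_one, Matrix.mul_zero, trace_zero] at this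
  linarith

end Alternative

/-! ### Schur complement as a minimum over gains -/

section Schur

variable {n m : ℕ}

/-- The matrix `[I; K]` of the graph of a gain `K`. -/
noncomputable def graphMat (K : Matrix (Fin m) (Fin n) ℝ) : Matrix (Fin n ⊕ Fin m) (Fin n) ℝ :=
  fromRows 1 K

/-- The minimizing gain `-F₂₂⁻¹F₁₂ᵀ` of the quadratic form with matrix `F`. -/
noncomputable def gain (F : Matrix (Fin n ⊕ Fin m) (Fin n ⊕ Fin m) ℝ) : Matrix (Fin m) (Fin n) ℝ :=
  -(F.toBlocks₂₂⁻¹ * F.toBlocks₁₂ᵀ)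

theorem isSymm_eq_fromBlocks {F : Matrix (Fin n ⊕ Fin m) (Fin n ⊕ Fin m) ℝ} (hF : Fᵀ = F) :
    F = fromBlocks F.toBlocks₁₁ F.toBlocks₁₂ F.toBlocks₁₂ᵀ F.toBlocks₂₂ ∧
      F.toBlocks₁₁ᵀ = F.toBlocks₁₁ ∧ F.toBlocks₂₂ᵀ = F.toBlocks₂₂ := by
  have h := fun i j => congrFun (congrFun hF i) j
  simp only [transpose_apply] at h
  refine ⟨?_, ?_, ?_⟩
  · ext (i | i) (j | j) <;> simp [toBlocks₁₁, toBlocks₁₂, toBlocks₂₂, h]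
  · ext i j; simp [toBlocks₁₁, h]
  · ext i j; simp [toBlocks₂₂, h]

theorem graphMat_conj (K : Matrix (Fin m) (Fin n) ℝ) (a : Matrix (Fin n) (Fin n) ℝ)
    (b : Matrix (Fin n) (Fin m) ℝ) (c : Matrix (Fin m) (Fin n) ℝ) (d : Matrix (Fin m) (Fin m) ℝ) :
    (graphMat K)ᵀ * fromBlocks a b c d * graphMat K = a + b * K + Kᵀ * c + Kᵀ * d * K := by
  rw [graphMat, transpose_fromRows, fromCols_mul_fromBlocks, fromCols_mul_fromRows]
  simp only [transpose_one, Matrix.one_mul, Matrix.mul_one, Matrix.add_mul]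
  abel

/-- Completion of squares. -/
theorem graphMat_conj_eq_schur {F : Matrix (Fin n ⊕ Fin m) (Fin n ⊕ Fin m) ℝ} (hF : Fᵀ = F)
    (hF₂ : F.toBlocks₂₂.PosDef) (K : Matrix (Fin m) (Fin n) ℝ) :
    (graphMat K)ᵀ * F * graphMat K =
      schur F + (K - gain F)ᵀ * F.toBlocks₂₂ * (K - gain F) := by
  obtain ⟨h, h11, h22⟩ := isSymm_eq_fromBlocks hF
  have e : (graphMat K)ᵀ * F * graphMat K = F.toBlocks₁₁ + F.toBlocks₁₂ * K + Kᵀ * F.toBlocks₁₂ᵀ +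
      Kᵀ * F.toBlocks₂₂ * K := by
    rw [← graphMat_conj, ← h]
  rw [e, schur, gain]
  generalize F.toBlocks₁₁ = a, F.toBlocks₁₂ = b, F.toBlocks₂₂ = d at *
  have hd : IsUnit d.det := (isUnit_iff_isUnit_det d).1 hF₂.isUnit
  simp only [sub_neg_eq_add, transpose_add, transpose_mul, transpose_transpose,
    transpose_nonsing_inv, h22]
  simp only [Matrix.add_mul, Matrix.mul_add, Matrix.mul_assoc]
  rw [nonsing_inv_mul_cancel_left _ _ hd, mul_nonsing_inv_cancel_left _ _ hd]
  abel

/-- The square left over after completion is nonnegative, and it vanishes at `K = gain F`. Thus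
`schur F` is the least compression of `F` to a graph. -/
theorem schur_le_conj {F : Matrix (Fin n ⊕ Fin m) (Fin n ⊕ Fin m) ℝ} (hF : Fᵀ = F)
    (hF₂ : F.toBlocks₂₂.PosDef) (K : Matrix (Fin m) (Fin n) ℝ) :
    schur F ≤ (graphMat K)ᵀ * F * graphMat K := by
  rw [graphMat_conj_eq_schur hF hF₂]
  exact le_add_of_nonneg_right (conj_nonneg (nonneg_iff_posSemidef.2 hF₂.posSemidef) _)

theorem schur_eq_conj_gain {F : Matrix (Fin n ⊕ Fin m) (Fin n ⊕ Fin m) ℝ} (hF : Fᵀ = F)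
    (hF₂ : F.toBlocks₂₂.PosDef) :
    schur F = (graphMat (gain F))ᵀ * F * graphMat (gain F) := by
  simp [graphMat_conj_eq_schur hF hF₂]

theorem schur_transpose {F : Matrix (Fin n ⊕ Fin m) (Fin n ⊕ Fin m) ℝ} (hF : Fᵀ = F)
    (hF₂ : F.toBlocks₂₂.PosDef) : (schur F)ᵀ = schur F := by
  rw [schur_eq_conj_gain hF hF₂]
  simp [transpose_mul, hF, Matrix.mul_assoc]

end Schur

/-! ### Riccati operator and value iteration -/

section Riccati

variable {n m : ℕ} {α σ : ℝ} {A A₁ : Matrix (Fin n) (Fin n) ℝ} {B B₁ : Matrix (Fin n) (Fin m) ℝ}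
  {Q : Matrix (Fin n) (Fin n) ℝ} {R : Matrix (Fin m) (Fin m) ℝ}

theorem qParam_eq (P : Matrix (Fin n) (Fin n) ℝ) (hP : Pᵀ = P) :
    qParam α σ A A₁ B B₁ Q R P = α • ((fromCols A B)ᵀ * P * fromCols A B) + fromBlocks Q 0 0 R +
      (α * σ) • ((fromCols A₁ B₁)ᵀ * P * fromCols A₁ B₁) := by
  have e (C : Matrix (Fin n) (Fin n) ℝ) (D : Matrix (Fin n) (Fin m) ℝ) :
      (fromCols C D)ᵀ * P * fromCols C D =
        fromBlocks (Cᵀ * P * C) (Cᵀ * P * D) (Dᵀ * P * C) (Dᵀ * P * D) := by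
    rw [transpose_fromCols, fromRows_mul, fromRows_mul_fromCols]
  simp only [e, qParam, fromBlocks_smul,
    fromBlocks_add, transpose_add, transpose_smul, transpose_mul, transpose_transpose, hP, add_zero]
  congr 1 <;> simp only [Matrix.mul_assoc] <;> abel

theorem qParam_transpose (hQ : Qᵀ = Q) (hR : Rᵀ = R) {P : Matrix (Fin n) (Fin n) ℝ} (hP : Pᵀ = P) :
    (qParam α σ A A₁ B B₁ Q R P)ᵀ = qParam α σ A A₁ B B₁ Q R P := by
  simp [qParam, fromBlocks_transpose, hQ, hR, hP, transpose_mul, Matrix.mul_assoc]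

theorem qParam_toBlocks₂₂_posDef (hα : 0 ≤ α) (hσ : 0 ≤ σ) (hR : R.PosDef)
    {P : Matrix (Fin n) (Fin n) ℝ} (hP : 0 ≤ P) :
    (qParam α σ A A₁ B B₁ Q R P).toBlocks₂₂.PosDef := by
  simp only [qParam, toBlocks_fromBlocks₂₂]
  refine posDef_of_le hR ?_
  rw [add_assoc]
  exact le_add_of_nonneg_right (add_nonneg (smul_nonneg hα (conj_nonneg hP _))
    (smul_nonneg (mul_nonneg hα hσ) (conj_nonneg hP _)))

/-- On the graph `u = K x` the Q-function becomes the one-step cost of the policy `K` followed by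
the value `P`. -/
theorem conj_qParam (P : Matrix (Fin n) (Fin n) ℝ) (hP : Pᵀ = P) (K : Matrix (Fin m) (Fin n) ℝ) :
    (graphMat K)ᵀ * qParam α σ A A₁ B B₁ Q R P * graphMat K =
      Q + Kᵀ * R * K + lyap α (α * σ) (A + B * K) (A₁ + B₁ * K) P := by
  rw [qParam, graphMat_conj, lyap_apply]
  simp only [transpose_add, transpose_smul, transpose_mul, transpose_transpose, hP, Matrix.add_mul,
    Matrix.mul_add, smul_add, Matrix.smul_mul, Matrix.mul_smul, Matrix.mul_assoc]
  abel

theorem schur_qParam {P : Matrix (Fin n) (Fin n) ℝ} (hP : Pᵀ = P) :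
    schur (qParam α σ A A₁ B B₁ Q R P) = riccati α σ A A₁ B B₁ Q R P := by
  simp only [schur, qParam, riccati, toBlocks_fromBlocks₁₁, toBlocks_fromBlocks₁₂,
    toBlocks_fromBlocks₂₂]
  have e : α • (Aᵀ * P * B) + (α * σ) • (A₁ᵀ * P * B₁) =
      α • (Aᵀ * P * B + σ • (A₁ᵀ * P * B₁)) := by rw [smul_add, smul_smul]
  have e' : (Aᵀ * P * B + σ • (A₁ᵀ * P * B₁))ᵀ = Bᵀ * P * A + σ • (B₁ᵀ * P * A₁) := by
    simp [transpose_mul, hP, Matrix.mul_assoc]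
  rw [e, transpose_smul, e']
  simp only [Matrix.smul_mul, Matrix.mul_smul, smul_smul, sq]

/-- As a Schur complement, the Riccati operator is the minimum over `K` of the policy evaluation
maps; `riccati_eq` gives attainment at the greedy gain. -/
theorem riccati_le (hα : 0 ≤ α) (hσ : 0 ≤ σ) (hQ : Qᵀ = Q) (hR : R.PosDef)
    {P : Matrix (Fin n) (Fin n) ℝ} (hP : 0 ≤ P) (K : Matrix (Fin m) (Fin n) ℝ) :
    riccati α σ A A₁ B B₁ Q R P ≤
      Q + Kᵀ * R * K + lyap α (α * σ) (A + B * K) (A₁ + B₁ * K) P := by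
  have hPt := transpose_eq_of_nonneg hP
  have hRt := transpose_eq_of_nonneg (nonneg_iff_posSemidef.2 hR.posSemidef)
  rw [← schur_qParam hPt, ← conj_qParam P hPt]
  exact schur_le_conj (qParam_transpose hQ hRt hPt) (qParam_toBlocks₂₂_posDef hα hσ hR hP) K

theorem riccati_eq (hα : 0 ≤ α) (hσ : 0 ≤ σ) (hQ : Qᵀ = Q) (hR : R.PosDef)
    {P : Matrix (Fin n) (Fin n) ℝ} (hP : 0 ≤ P) {K : Matrix (Fin m) (Fin n) ℝ}
    (hK : K = gain (qParam α σ A A₁ B B₁ Q R P)) :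
    riccati α σ A A₁ B B₁ Q R P =
      Q + Kᵀ * R * K + lyap α (α * σ) (A + B * K) (A₁ + B₁ * K) P := by
  have hPt := transpose_eq_of_nonneg hP
  have hRt := transpose_eq_of_nonneg (nonneg_iff_posSemidef.2 hR.posSemidef)
  rw [← schur_qParam hPt, ← conj_qParam P hPt, hK]
  exact schur_eq_conj_gain (qParam_transpose hQ hRt hPt) (qParam_toBlocks₂₂_posDef hα hσ hR hP)

theorem stageCost_nonneg (hQ : 0 ≤ Q) (hR : R.PosDef) (K : Matrix (Fin m) (Fin n) ℝ) :
    0 ≤ Q + Kᵀ * R * K :=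
  add_nonneg hQ (conj_nonneg (nonneg_iff_posSemidef.2 hR.posSemidef) K)

theorem riccati_nonneg (hα : 0 ≤ α) (hσ : 0 ≤ σ) (hQ : 0 ≤ Q) (hR : R.PosDef)
    {P : Matrix (Fin n) (Fin n) ℝ} (hP : 0 ≤ P) : 0 ≤ riccati α σ A A₁ B B₁ Q R P := by
  rw [riccati_eq hα hσ (transpose_eq_of_nonneg hQ) hR hP rfl]
  exact add_nonneg (stageCost_nonneg hQ hR _) (lyap_nonneg hα (mul_nonneg hα hσ) hP)

/-- The greedy gain of `P'` is a competitor for `P`, and policy evaluation with a fixed gain is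
monotone. -/
theorem riccati_mono (hα : 0 ≤ α) (hσ : 0 ≤ σ) (hQ : Qᵀ = Q) (hR : R.PosDef)
    {P P' : Matrix (Fin n) (Fin n) ℝ} (hP : 0 ≤ P) (h : P ≤ P') :
    riccati α σ A A₁ B B₁ Q R P ≤ riccati α σ A A₁ B B₁ Q R P' := by
  rw [riccati_eq hα hσ hQ hR (hP.trans h) rfl]
  exact (riccati_le hα hσ hQ hR hP _).trans (add_le_add le_rfl (lyap_mono hα (mul_nonneg hα hσ) h))

/-- Monotone bounded sequences of matrices converge. -/
theorem exists_tendsto_of_monotone {P : ℕ → Matrix (Fin n) (Fin n) ℝ} (hP : Monotone P)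
    (h0 : ∀ k, 0 ≤ P k) {Z : Matrix (Fin n) (Fin n) ℝ} (hZ : ∀ k, P k ≤ Z) :
    ∃ L, 0 ≤ L ∧ Tendsto P atTop (𝓝 L) := by
  have hq : ∀ x : Fin n → ℝ, ∃ l, Tendsto (fun k => x ⬝ᵥ P k *ᵥ x) atTop (𝓝 l) := fun x =>
    ⟨_, tendsto_atTop_ciSup (fun i j hij => quadForm_mono (hP hij) x)
      ⟨x ⬝ᵥ Z *ᵥ x, by rintro _ ⟨k, rfl⟩; exact quadForm_mono (hZ k) x⟩⟩
  have hent : ∀ i j, ∃ l, Tendsto (fun k => P k i j) atTop (𝓝 l) := by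
    intro i j
    -- Polarization recovers the entries from convergent quadratic forms.
    obtain ⟨l1, h1⟩ := hq (Pi.single i 1 + Pi.single j 1)
    obtain ⟨l2, h2⟩ := hq (Pi.single i 1)
    obtain ⟨l3, h3⟩ := hq (Pi.single j 1)
    refine ⟨(l1 - l2 - l3) / 2, (((h1.sub h2).sub h3).div_const 2).congr fun k => ?_⟩
    have hs : P k j i = P k i j := congrFun (congrFun (transpose_eq_of_nonneg (h0 k)) i) j
    simp only [mulVec_add, dotProduct_add, add_dotProduct, mulVec_single_one, single_one_dotProduct,
      Matrix.col_apply, hs]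
    ring
  choose L hL using hent
  have hT : Tendsto P atTop (𝓝 (Matrix.of L)) :=
    tendsto_pi_nhds.2 fun i => tendsto_pi_nhds.2 fun j => hL i j
  refine ⟨Matrix.of L, ?_, hT⟩
  rw [nonneg_iff_posSemidef, posSemidef_iff_quadForm]
  constructor
  · refine tendsto_nhds_unique ?_ hT
    refine ((continuous_id.matrix_transpose.tendsto _).comp hT).congr fun k => ?_
    exact transpose_eq_of_nonneg (h0 k)
  · intro x
    have hc : Continuous fun M : Matrix (Fin n) (Fin n) ℝ => x ⬝ᵥ M *ᵥ x := by fun_prop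
    refine ge_of_tendsto' ((hc.tendsto _).comp hT) fun k => ?_
    exact (posSemidef_iff_quadForm.1 (nonneg_iff_posSemidef.1 (h0 k))).2 x

theorem continuousAt_riccati (hα : 0 ≤ α) (hσ : 0 ≤ σ) (hR : R.PosDef)
    {P : Matrix (Fin n) (Fin n) ℝ} (hP : 0 ≤ P) :
    ContinuousAt (riccati α σ A A₁ B B₁ Q R) P := by
  have h22 := qParam_toBlocks₂₂_posDef (A := A) (A₁ := A₁) (B := B) (B₁ := B₁) (Q := Q) hα hσ hR hP
  simp only [qParam, toBlocks_fromBlocks₂₂] at h22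
  have hinv : ContinuousAt
      (fun P => (R + α • (Bᵀ * P * B) + (α * σ) • (B₁ᵀ * P * B₁))⁻¹) P := by
    refine ContinuousAt.comp (g := Inv.inv)
      (f := fun P => R + α • (Bᵀ * P * B) + (α * σ) • (B₁ᵀ * P * B₁)) ?_ ?_
    · refine continuousAt_matrix_inv _ ?_
      rw [Ring.inverse_eq_inv']
      exact continuousAt_inv₀ ((isUnit_iff_isUnit_det _).1 h22.isUnit).ne_zero
    · fun_prop
  unfold riccati
  have hmul {k l r : ℕ} {f : Matrix (Fin n) (Fin n) ℝ → Matrix (Fin k) (Fin l) ℝ}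
      {g : Matrix (Fin n) (Fin n) ℝ → Matrix (Fin l) (Fin r) ℝ} (hf : ContinuousAt f P)
      (hg : ContinuousAt g P) : ContinuousAt (fun P => f P * g P) P :=
    Tendsto.comp ((continuous_fst.matrix_mul continuous_snd).tendsto (f P, g P))
      (hf.prodMk_nhds hg)
  refine ContinuousAt.sub (by fun_prop) (ContinuousAt.fun_const_smul ?_ _)
  exact hmul (hmul (by fun_prop) hinv) (by fun_prop)

/-- Value iteration converges to a positive semidefinite solution of the Riccati equation. -/
theorem exists_isRiccatiSolution (hα : 0 ≤ α) (hσ : 0 ≤ σ) (hQ : 0 ≤ Q) (hR : R.PosDef)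
    {K : Matrix (Fin m) (Fin n) ℝ} {Y : Matrix (Fin n) (Fin n) ℝ} (hY : Y.PosDef)
    (hYs : (Y - lyap α (α * σ) (A + B * K) (A₁ + B₁ * K) Y).PosDef) :
    ∃ P, IsRiccatiSolution α σ A A₁ B B₁ Q R P := by
  have hασ := mul_nonneg hα hσ
  have hQt := transpose_eq_of_nonneg hQ
  -- This `c` makes `c • Y` absorb the stage cost of `K`, hence a supersolution of the Riccati
  -- equation and an upper bound for the iterates.
  obtain ⟨c, hc, hcY⟩ := exists_smul_le hYs (transpose_eq_of_nonneg (stageCost_nonneg hQ hR K))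
  set ℛ := riccati α σ A A₁ B B₁ Q R with hℛ
  have hZ0 : 0 ≤ c • Y := smul_nonneg hc.le (nonneg_iff_posSemidef.2 hY.posSemidef)
  have hZ : ℛ (c • Y) ≤ c • Y := by
    refine (riccati_le hα hσ hQt hR hZ0 K).trans ?_
    rw [map_smul, ← le_sub_iff_add_le, ← smul_sub]
    exact hcY
  have hb : ∀ k, 0 ≤ ℛ^[k] 0 ∧ ℛ^[k] 0 ≤ c • Y := by
    intro k
    induction k with
    | zero => exact ⟨le_rfl, hZ0⟩
    | succ k ih =>
      rw [Function.iterate_succ_apply']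
      exact ⟨riccati_nonneg hα hσ hQ hR ih.1, (riccati_mono hα hσ hQt hR ih.1 ih.2).trans hZ⟩
  have hm : Monotone fun k => ℛ^[k] 0 := by
    refine monotone_nat_of_le_succ fun k => ?_
    induction k with
    | zero => exact (hb 1).1
    | succ k ih =>
      rw [Function.iterate_succ_apply', Function.iterate_succ_apply' _ (k + 1)]
      exact riccati_mono hα hσ hQt hR (hb k).1 ih
  obtain ⟨P, hP0, hP⟩ := exists_tendsto_of_monotone hm (fun k => (hb k).1) fun k => (hb k).2
  refine ⟨P, nonneg_iff_posSemidef.1 hP0, tendsto_nhds_unique ((tendsto_add_atTop_iff_nat 1).2 hP) ?_⟩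
  refine ((continuousAt_riccati hα hσ hR hP0).tendsto.comp hP).congr fun k => ?_
  exact (Function.iterate_succ_apply' ℛ k 0).symm

end Riccati

/-! ### Stability from stabilizability and from detectability -/

section Stability

variable {n m : ℕ} {α σ : ℝ} {A A₁ : Matrix (Fin n) (Fin n) ℝ} {B B₁ : Matrix (Fin n) (Fin m) ℝ}
  {Q : Matrix (Fin n) (Fin n) ℝ} {R : Matrix (Fin m) (Fin m) ℝ}

theorem lyap_discount (G H X : Matrix (Fin n) (Fin n) ℝ) :
    lyap α (α * σ) G H X = α • lyap 1 σ G H X := by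
  simp [lyap_apply, smul_smul]

theorem lyap_iterate_discount (G H X : Matrix (Fin n) (Fin n) ℝ) (k : ℕ) :
    (lyap α (α * σ) G H)^[k] X = α ^ k • (lyap 1 σ G H)^[k] X := by
  induction k with
  | zero => simp
  | succ k ih =>
    rw [Function.iterate_succ_apply', Function.iterate_succ_apply', ih, map_smul, lyap_discount,
      smul_smul, pow_succ]

theorem lyap_iterate_nonneg {a b : ℝ} (ha : 0 ≤ a) (hb : 0 ≤ b) (G H : Matrix (Fin n) (Fin n) ℝ)
    {X : Matrix (Fin n) (Fin n) ℝ} (hX : 0 ≤ X) (k : ℕ) : 0 ≤ (lyap a b G H)^[k] X := by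
  induction k with
  | zero => exact hX
  | succ k ih =>
    rw [Function.iterate_succ_apply']
    exact lyap_nonneg ha hb ih

theorem lyap_iterate_mono {a b : ℝ} (ha : 0 ≤ a) (hb : 0 ≤ b) (G H : Matrix (Fin n) (Fin n) ℝ)
    (k : ℕ) : Monotone (lyap a b G H)^[k] :=
  Monotone.iterate (fun _ _ h => lyap_mono ha hb h) k

theorem trace_mono {X Y : Matrix (Fin n) (Fin n) ℝ} (h : X ≤ Y) : X.trace ≤ Y.trace := by
  have := (le_iff.1 h).trace_nonneg
  rwa [trace_sub, sub_nonneg] at this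

theorem eq_zero_of_trace_nonpos {X : Matrix (Fin n) (Fin n) ℝ} (hX : 0 ≤ X) (h : X.trace ≤ 0) :
    X = 0 := by
  have h0 : X.trace = 0 := le_antisymm h (by simpa using trace_mono hX)
  have := mul_eq_zero_of_trace_eq_zero (P := 1) (nonneg_iff_posSemidef.2 PosSemidef.one) hX
    (by rwa [Matrix.one_mul])
  rwa [Matrix.one_mul] at this

/-- If the undiscounted second moment of a homogeneous system vanishes asymptotically, its
discounted Lyapunov operator has a strict supersolution. -/
theorem exists_lyap_of_tendsto (hα₀ : 0 ≤ α) (hα₁ : α ≤ 1) (hσ : 0 ≤ σ)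
    {G H X₀ : Matrix (Fin n) (Fin n) ℝ} (hX₀ : X₀.PosDef)
    (h : Tendsto (fun k => ((lyap 1 σ Gᵀ Hᵀ)^[k] X₀).trace) atTop (𝓝 0)) :
    ∃ Y : Matrix (Fin n) (Fin n) ℝ, Y.PosDef ∧ (Y - lyap α (α * σ) G H Y).PosDef := by
  refine lyap_alternative hα₀ (mul_nonneg hα₀ hσ) G H fun X hX hle => ?_
  set T := lyap 1 σ Gᵀ Hᵀ with hT
  have hle' : X ≤ T X := by
    refine hle.trans ?_
    rw [lyap_discount]
    have := smul_le_smul_of_nonneg_right hα₁ (lyap_nonneg (G := Gᵀ) (H := Hᵀ) zero_le_one hσ hX)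
    rwa [one_smul] at this
  have hmono : ∀ k, X ≤ T^[k] X := by
    intro k
    induction k with
    | zero => exact le_rfl
    | succ k ih =>
      rw [Function.iterate_succ_apply']
      exact hle'.trans (lyap_mono zero_le_one hσ ih)
  -- A subsolution satisfies `X ≤ T^[k] X ≤ c • T^[k] X₀`, whose trace tends to zero.
  obtain ⟨c, -, hc⟩ := exists_smul_le hX₀ (transpose_eq_of_nonneg hX)
  refine eq_zero_of_trace_nonpos hX ?_
  have hlim := h.const_mul c
  rw [mul_zero] at hlim
  refine ge_of_tendsto' hlim fun k => ?_
  have h1 := trace_mono ((hmono k).trans (lyap_iterate_mono zero_le_one hσ _ _ k hc))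
  rwa [← hT, ← Module.End.pow_apply, map_smul, Module.End.pow_apply, trace_smul, smul_eq_mul] at h1

/-- Deterministic form of exact detectability: a state whose second moment is never seen by `Q`
vanishes asymptotically in mean square. -/
def IsMomentDetectable (σ : ℝ) (A A₁ Q : Matrix (Fin n) (Fin n) ℝ) : Prop :=
  ∀ ξ : Fin n → ℝ, (∀ k, (Q * (lyap 1 σ Aᵀ A₁ᵀ)^[k] (vecMulVec ξ ξ)).trace = 0) →
    Tendsto (fun k => ((lyap 1 σ Aᵀ A₁ᵀ)^[k] (vecMulVec ξ ξ)).trace) atTop (𝓝 0)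

/-- Split `X` into rank-one terms. Their costs are nonnegative and sum to zero, so each is zero and
detectability applies termwise. -/
theorem IsMomentDetectable.tendsto (hdet : IsMomentDetectable σ A A₁ Q) (hσ : 0 ≤ σ) (hQ : 0 ≤ Q)
    {X : Matrix (Fin n) (Fin n) ℝ} (hX : 0 ≤ X)
    (h : ∀ k, (Q * (lyap 1 σ Aᵀ A₁ᵀ)^[k] X).trace = 0) :
    Tendsto (fun k => ((lyap 1 σ Aᵀ A₁ᵀ)^[k] X).trace) atTop (𝓝 0) := by
  obtain ⟨ξ, rfl⟩ := exists_eq_sum_vecMulVec hX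
  simp only [← Module.End.pow_apply, map_sum, trace_sum, Matrix.mul_sum] at h ⊢
  have h0 : ∀ k i, (Q * ((lyap 1 σ Aᵀ A₁ᵀ) ^ k) (vecMulVec (ξ i) (ξ i))).trace = 0 := by
    intro k i
    refine (Finset.sum_eq_zero_iff_of_nonneg fun j _ => ?_).1 (h k) i (Finset.mem_univ i)
    rw [Module.End.pow_apply]
    exact trace_mul_nonneg hQ (lyap_iterate_nonneg zero_le_one hσ _ _ (vecMulVec_nonneg _) k)
  have := tendsto_finsetSum Finset.univ fun i _ => hdet (ξ i) fun k => by
    rw [← Module.End.pow_apply]; exact h0 k i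
  simpa [Module.End.pow_apply] using this

/-- If `X ≥ 0` is a subsolution of the closed loop moment operator, the closed loop incurs no cost
on `X` and agrees with the uncontrolled system there. -/
theorem no_cost_of_subsolution (hQ : 0 ≤ Q) (hR : R.PosDef)
    {P : Matrix (Fin n) (Fin n) ℝ} (hP : 0 ≤ P) {K : Matrix (Fin m) (Fin n) ℝ}
    (hPK : P = Q + Kᵀ * R * K + lyap α (α * σ) (A + B * K) (A₁ + B₁ * K) P)
    {X : Matrix (Fin n) (Fin n) ℝ} (hX : 0 ≤ X)
    (hle : X ≤ lyap α (α * σ) (A + B * K)ᵀ (A₁ + B₁ * K)ᵀ X) :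
    (Q * X).trace = 0 ∧
      lyap α (α * σ) (A + B * K)ᵀ (A₁ + B₁ * K)ᵀ X = lyap α (α * σ) Aᵀ A₁ᵀ X := by
  have hR0 := nonneg_iff_posSemidef.2 hR.posSemidef
  -- Pairing the equation for `P` with `X` and moving `lyap` to its adjoint: as `P` pairs at least
  -- as much with the image of `X` as with `X`, both nonnegative cost terms must vanish.
  have h1 : (P * X).trace = (Q * X).trace + (Kᵀ * R * K * X).trace +
      (P * lyap α (α * σ) (A + B * K)ᵀ (A₁ + B₁ * K)ᵀ X).trace := by
    conv_lhs => rw [hPK]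
    rw [trace_mul_lyap]
    simp only [Matrix.add_mul, trace_add]
  have h2 := trace_mul_nonneg hP (sub_nonneg.2 hle)
  rw [Matrix.mul_sub, trace_sub] at h2
  have h3 := trace_mul_nonneg hQ hX
  have h4 := trace_mul_nonneg (conj_nonneg hR0 K) hX
  refine ⟨by linarith, ?_⟩
  have h5 : (Kᵀ * R * K * X).trace = 0 := by linarith
  have hKX0 : 0 ≤ K * X * Kᵀ := by simpa using conj_nonneg hX Kᵀ
  have h6 : R * (K * X * Kᵀ) = 0 := by
    refine mul_eq_zero_of_trace_eq_zero hR0 hKX0 ?_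
    rw [← h5, Matrix.mul_assoc Kᵀ, Matrix.mul_assoc Kᵀ, Matrix.trace_mul_comm Kᵀ]
    simp only [Matrix.mul_assoc]
  have h7 : K * X * Kᵀ = 0 := by
    have := congrArg (R⁻¹ * ·) h6
    simpa [nonsing_inv_mul_cancel_left _ _ ((isUnit_iff_isUnit_det R).1 hR.isUnit)] using this
  have h8 : X * Kᵀ = 0 := by
    obtain ⟨b, rfl⟩ := CStarAlgebra.nonneg_iff_eq_star_mul_self.1 hX
    simp only [star_eq_conjTranspose, conjTranspose_eq_transpose_of_trivial] at h7 ⊢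
    have : (b * Kᵀ)ᴴ * (b * Kᵀ) = 0 := by
      rw [conjTranspose_eq_transpose_of_trivial, transpose_mul, transpose_transpose, ← h7]
      simp only [Matrix.mul_assoc]
    rw [Matrix.mul_assoc, conjTranspose_mul_self_eq_zero.1 this, Matrix.mul_zero]
  have h9 : K * X = 0 := by
    have := congrArg transpose h8
    rwa [transpose_mul, transpose_transpose, transpose_eq_of_nonneg hX, transpose_zero] at this
  have key (C : Matrix (Fin n) (Fin n) ℝ) (D : Matrix (Fin n) (Fin m) ℝ) :
      (C + D * K) * X * (C + D * K)ᵀ = C * X * Cᵀ := by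
    rw [Matrix.add_mul, Matrix.mul_assoc D, h9, Matrix.mul_zero, add_zero, transpose_add,
      transpose_mul, Matrix.mul_add, ← Matrix.mul_assoc _ Kᵀ, Matrix.mul_assoc C X Kᵀ, h8]
    simp
  simp only [lyap_apply, transpose_transpose, key]

/-- Solutions of the Riccati equation have stabilizing gains. -/
theorem exists_lyap_of_solution (hα₀ : 0 ≤ α) (hα₁ : α ≤ 1) (hσ : 0 ≤ σ) (hQ : 0 ≤ Q)
    (hR : R.PosDef) (hdet : IsMomentDetectable σ A A₁ Q) {P : Matrix (Fin n) (Fin n) ℝ}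
    (hP : 0 ≤ P) {K : Matrix (Fin m) (Fin n) ℝ}
    (hPK : P = Q + Kᵀ * R * K + lyap α (α * σ) (A + B * K) (A₁ + B₁ * K) P) :
    ∃ Y : Matrix (Fin n) (Fin n) ℝ, Y.PosDef ∧
      (Y - lyap α (α * σ) (A + B * K) (A₁ + B₁ * K) Y).PosDef := by
  have hασ := mul_nonneg hα₀ hσ
  refine lyap_alternative hα₀ hασ _ _ fun X hX hle => ?_
  set T := lyap α (α * σ) (A + B * K)ᵀ (A₁ + B₁ * K)ᵀ with hT
  set S := lyap α (α * σ) Aᵀ A₁ᵀ with hS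
  -- On subsolutions `S` and `T` agree, so the open-loop orbit of `X` consists of subsolutions of
  -- `T` and never drops below `X`.
  have hk : ∀ k, 0 ≤ S^[k] X ∧ X ≤ S^[k] X ∧ S^[k] X ≤ T (S^[k] X) := by
    intro k
    induction k with
    | zero => exact ⟨hX, le_rfl, hle⟩
    | succ k ih =>
      obtain ⟨h1, h2, h3⟩ := ih
      have h4 := (no_cost_of_subsolution hQ hR hP hPK h1 h3).2
      rw [Function.iterate_succ_apply', hS, ← h4, ← hT]
      exact ⟨h1.trans h3, h2.trans h3, lyap_mono hα₀ hασ h3⟩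
  have hle1 : ∀ k, X ≤ (lyap 1 σ Aᵀ A₁ᵀ)^[k] X := by
    intro k
    refine (hk k).2.1.trans ?_
    rw [hS, lyap_iterate_discount]
    have := smul_le_smul_of_nonneg_right (pow_le_one₀ (n := k) hα₀ hα₁)
      (lyap_iterate_nonneg zero_le_one hσ Aᵀ A₁ᵀ hX k)
    rwa [one_smul] at this
  -- The factor `α ^ k` is cancelled below, so `α = 0` is treated apart.
  rcases hα₀.eq_or_lt with rfl | hαpos
  · have : T X = 0 := by simp [hT, lyap_apply]
    exact le_antisymm (hle.trans_eq this) hX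
  refine eq_zero_of_trace_nonpos hX (ge_of_tendsto' (hdet.tendsto hσ hQ hX fun k => ?_)
    fun k => trace_mono (hle1 k))
  have h5 := (no_cost_of_subsolution hQ hR hP hPK (hk k).1 (hk k).2.2).1
  rw [hS, lyap_iterate_discount, Matrix.mul_smul, trace_smul, smul_eq_mul] at h5
  exact (mul_eq_zero.1 h5).resolve_left (pow_pos hαpos k).ne'

/-- A subsolution of the Riccati equation lies below every positive semidefinite solution. -/
theorem le_of_isRiccatiSolution (hα₀ : 0 ≤ α) (hα₁ : α ≤ 1) (hσ : 0 ≤ σ) (hQ : 0 ≤ Q)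
    (hR : R.PosDef) (hdet : IsMomentDetectable σ A A₁ Q) {P : Matrix (Fin n) (Fin n) ℝ}
    (hP : IsRiccatiSolution α σ A A₁ B B₁ Q R P) {S : Matrix (Fin n) (Fin n) ℝ} (hS : Sᵀ = S)
    (hle : ∀ K : Matrix (Fin m) (Fin n) ℝ,
      S ≤ Q + Kᵀ * R * K + lyap α (α * σ) (A + B * K) (A₁ + B₁ * K) S) : S ≤ P := by
  have hP0 := nonneg_iff_posSemidef.2 hP.1
  set K := gain (qParam α σ A A₁ B B₁ Q R P) with hK
  have hPK := hP.2.trans (riccati_eq hα₀ hσ (transpose_eq_of_nonneg hQ) hR hP0 hK)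
  obtain ⟨Y, hY, hYs⟩ := exists_lyap_of_solution hα₀ hα₁ hσ hQ hR hdet hP0 hPK
  refine sub_nonneg.1 (nonneg_of_lyap_le hα₀ (mul_nonneg hα₀ hσ) hY hYs ?_ ?_)
  -- For the gain of `P`, the equation for `P` minus the inequality for `S` cancels the stage cost
  -- and leaves `lyap (P - S) ≤ P - S`.
  · rw [map_sub, sub_le_sub_iff]
    have := add_le_add (hle K) (le_refl (lyap α (α * σ) (A + B * K) (A₁ + B₁ * K) P))
    conv_rhs => rw [hPK]
    refine (add_comm _ _).trans_le (this.trans_eq ?_)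
    abel
  · rw [transpose_sub, hS, transpose_eq_of_nonneg hP0]

theorem isRiccatiSolution_unique (hα₀ : 0 ≤ α) (hα₁ : α ≤ 1) (hσ : 0 ≤ σ) (hQ : 0 ≤ Q)
    (hR : R.PosDef) (hdet : IsMomentDetectable σ A A₁ Q) {P P' : Matrix (Fin n) (Fin n) ℝ}
    (hP : IsRiccatiSolution α σ A A₁ B B₁ Q R P)
    (hP' : IsRiccatiSolution α σ A A₁ B B₁ Q R P') : P' = P := by
  have key : ∀ {P P' : Matrix (Fin n) (Fin n) ℝ}, IsRiccatiSolution α σ A A₁ B B₁ Q R P →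
      IsRiccatiSolution α σ A A₁ B B₁ Q R P' → P' ≤ P := fun {P P'} hP hP' => by
    have h0 := nonneg_iff_posSemidef.2 hP'.1
    refine le_of_isRiccatiSolution hα₀ hα₁ hσ hQ hR hdet hP (transpose_eq_of_nonneg h0) fun K => ?_
    exact hP'.2.trans_le (riccati_le hα₀ hσ (transpose_eq_of_nonneg hQ) hR h0 K)
  exact le_antisymm (key hP hP') (key hP' hP)

end Stability

/-! ### Feasible and optimal points of the dual problem -/

section Dual

variable {n m : ℕ} {α σ : ℝ} {A A₁ : Matrix (Fin n) (Fin n) ℝ} {B B₁ : Matrix (Fin n) (Fin m) ℝ}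
  {Q : Matrix (Fin n) (Fin n) ℝ} {R : Matrix (Fin m) (Fin m) ℝ}
  {F : Matrix (Fin n ⊕ Fin m) (Fin n ⊕ Fin m) ℝ} {M P : Matrix (Fin n) (Fin n) ℝ}

theorem IsDualFeasible.le_qParam (h : IsDualFeasible α σ A A₁ B B₁ Q R F M) :
    F ≤ qParam α σ A A₁ B B₁ Q R (schur F) := by
  refine sub_nonneg.1 ((nonneg_iff_posSemidef.2 h.lmi).trans_eq ?_)
  rw [qParam_eq _ (schur_transpose h.symm h.posDef)]
  abel

theorem IsDualFeasible.le_schur (h : IsDualFeasible α σ A A₁ B B₁ Q R F M) : M ≤ schur F :=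
  h.schur_sub

/-- Compressing `F ≤ qParam (schur F)` to the graph of any `K` shows that `schur F` is a subsolution
for every policy. -/
theorem IsDualFeasible.schur_le (h : IsDualFeasible α σ A A₁ B B₁ Q R F M) (hα₀ : 0 ≤ α)
    (hα₁ : α ≤ 1) (hσ : 0 ≤ σ) (hQ : 0 ≤ Q) (hR : R.PosDef) (hdet : IsMomentDetectable σ A A₁ Q)
    (hP : IsRiccatiSolution α σ A A₁ B B₁ Q R P) : schur F ≤ P := by
  have hS := schur_transpose h.symm h.posDef
  refine le_of_isRiccatiSolution hα₀ hα₁ hσ hQ hR hdet hP hS fun K => ?_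
  rw [← conj_qParam _ hS]
  exact (schur_le_conj h.symm h.posDef K).trans (conj_mono h.le_qParam _)

theorem isDualFeasible_qParam (hα : 0 ≤ α) (hσ : 0 ≤ σ) (hQ : 0 ≤ Q) (hR : R.PosDef)
    (hP : IsRiccatiSolution α σ A A₁ B B₁ Q R P) :
    IsDualFeasible α σ A A₁ B B₁ Q R (qParam α σ A A₁ B B₁ Q R P) P := by
  have hP0 := nonneg_iff_posSemidef.2 hP.1
  have hPt := transpose_eq_of_nonneg hP0
  have hs : schur (qParam α σ A A₁ B B₁ Q R P) = P := by rw [schur_qParam hPt, ← hP.2]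
  refine ⟨qParam_transpose (transpose_eq_of_nonneg hQ)
    (transpose_eq_of_nonneg (nonneg_iff_posSemidef.2 hR.posSemidef)) hPt,
    qParam_toBlocks₂₂_posDef hα hσ hR hP0, ?_, ?_⟩
  · rw [hs, sub_self]
    exact PosSemidef.zero
  · rw [hs]
    have : (0 : Matrix (Fin n ⊕ Fin m) (Fin n ⊕ Fin m) ℝ).PosSemidef := PosSemidef.zero
    convert this using 1
    rw [qParam_eq P hPt]
    abel

/-- The optimal points of the dual problem, for any positive definite weight. -/
theorem isDualOptimal_iff (hα₀ : 0 ≤ α) (hα₁ : α ≤ 1) (hσ : 0 ≤ σ) (hQ : 0 ≤ Q) (hR : R.PosDef)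
    (hdet : IsMomentDetectable σ A A₁ Q) (hP : IsRiccatiSolution α σ A A₁ B B₁ Q R P)
    {X : Matrix (Fin n) (Fin n) ℝ} (hX : X.PosDef) :
    IsDualOptimal α σ A A₁ B B₁ Q R X F M ↔ IsDualFeasible α σ A A₁ B B₁ Q R F M ∧ M = P := by
  have hX0 := nonneg_iff_posSemidef.2 hX.posSemidef
  have hle : ∀ {F M}, IsDualFeasible α σ A A₁ B B₁ Q R F M → M ≤ P := fun h =>
    h.le_schur.trans (h.schur_le hα₀ hα₁ hσ hQ hR hdet hP)
  constructor
  · rintro ⟨hF, hopt⟩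
    refine ⟨hF, ?_⟩
    have h1 := hopt _ _ (isDualFeasible_qParam hα₀ hσ hQ hR hP)
    have hd := sub_nonneg.2 (hle hF)
    have h2 := trace_mul_nonneg hX0 hd
    -- Optimality forces the pairing of `X` with `P - M ≥ 0` to vanish; invertibility of `X` then
    -- gives `M = P`.
    have h3 : X * (P - M) = 0 := by
      refine mul_eq_zero_of_trace_eq_zero hX0 hd (le_antisymm ?_ h2)
      rw [Matrix.mul_sub, trace_sub]
      linarith
    have h4 := congrArg (X⁻¹ * ·) h3
    simp only [nonsing_inv_mul_cancel_left _ _ ((isUnit_iff_isUnit_det X).1 hX.isUnit),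
      Matrix.mul_zero] at h4
    exact (sub_eq_zero.1 h4).symm
  · rintro ⟨hF, rfl⟩
    refine ⟨hF, fun F' M' h' => ?_⟩
    have := trace_mul_nonneg hX0 (sub_nonneg.2 (hle h'))
    rw [Matrix.mul_sub, trace_sub] at this
    linarith

/-- The squeeze `P ≤ schur F ≤ P` makes both Schur complements equal to `P`. On the graph of `gain
H`, `F ≤ H` then leaves no room for the square in the gain difference, which vanishes since the
lower block of `F` is definite. -/
theorem IsDualFeasible.of_eq_solution (h : IsDualFeasible α σ A A₁ B B₁ Q R F P) (hα₀ : 0 ≤ α)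
    (hα₁ : α ≤ 1) (hσ : 0 ≤ σ) (hQ : 0 ≤ Q) (hR : R.PosDef) (hdet : IsMomentDetectable σ A A₁ Q)
    (hP : IsRiccatiSolution α σ A A₁ B B₁ Q R P) :
    F ≤ qParam α σ A A₁ B B₁ Q R P ∧ gain F = gain (qParam α σ A A₁ B B₁ Q R P) := by
  have hs : schur F = P := le_antisymm (h.schur_le hα₀ hα₁ hσ hQ hR hdet hP) h.le_schur
  have hle := h.le_qParam
  rw [hs] at hle
  refine ⟨hle, ?_⟩
  have hf := isDualFeasible_qParam hα₀ hσ hQ hR hP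
  set H := qParam α σ A A₁ B B₁ Q R P
  have hHs : schur H = P := le_antisymm (hf.schur_le hα₀ hα₁ hσ hQ hR hdet hP) hf.le_schur
  have h1 := conj_mono hle (graphMat (gain H))
  rw [← schur_eq_conj_gain hf.symm hf.posDef, graphMat_conj_eq_schur h.symm h.posDef, hs, hHs,
    add_le_iff_nonpos_right] at h1
  have h2 := le_antisymm h1 (conj_nonneg (nonneg_iff_posSemidef.2 h.posDef.posSemidef) _)
  by_contra hne
  obtain ⟨x, hx⟩ : ∃ x, (gain H - gain F) *ᵥ x ≠ 0 := by
    by_contra! h0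
    refine hne (sub_eq_zero.1 ?_).symm
    exact Matrix.ext_of_mulVec_single fun i => by rw [h0, zero_mulVec]
  have h3 := h.posDef.dotProduct_mulVec_pos hx
  have h4 : x ⬝ᵥ ((gain H - gain F)ᵀ * F.toBlocks₂₂ * (gain H - gain F)) *ᵥ x = 0 := by
    rw [h2]; simp
  rw [← mulVec_mulVec, ← mulVec_mulVec, dotProduct_mulVec, vecMul_transpose] at h4
  rw [star_trivial, h4] at h3
  exact h3.false

end Dual

/-! ### Independence of the state from the current noise -/

section Independence

theorem iIndep_sumElim {Ω ι κ : Type*} {m₁ : ι → MeasurableSpace Ω} {m₂ : κ → MeasurableSpace Ω}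
    {mΩ : MeasurableSpace Ω} {μ : Measure Ω} (h₁ : iIndep m₁ μ) (h₂ : iIndep m₂ μ)
    (h : Indep (⨆ i, m₁ i) (⨆ j, m₂ j) μ) : iIndep (Sum.elim m₁ m₂) μ := by
  rw [iIndep_iff]
  intro s f hf
  have e : ⋂ i ∈ s, f i =
      (⋂ i ∈ s.toLeft, f (Sum.inl i)) ∩ ⋂ j ∈ s.toRight, f (Sum.inr j) := by
    ext ω
    simp [Sum.forall]
  have hl : ∀ i ∈ s.toLeft, MeasurableSet[m₁ i] (f (Sum.inl i)) := fun i hi =>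
    hf (Sum.inl i) (Finset.mem_toLeft.1 hi)
  have hr : ∀ j ∈ s.toRight, MeasurableSet[m₂ j] (f (Sum.inr j)) := fun j hj =>
    hf (Sum.inr j) (Finset.mem_toRight.1 hj)
  rw [e, (Indep_iff _ _ μ).1 h, h₁.meas_biInter hl, h₂.meas_biInter hr]
  · conv_rhs => rw [← Finset.toLeft_disjSum_toRight (u := s), Finset.prod_disjSum]
  · exact Finset.measurableSet_biInter _ fun i hi => le_iSup m₁ i _ (hl i hi)
  · exact Finset.measurableSet_biInter _ fun j hj => le_iSup m₂ j _ (hr j hj)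

variable {Ω : Type u} {n : ℕ}

/-- The information available before time `k`. -/
abbrev past (w : ℕ → Ω → Fin n → ℝ) (v : ℕ → Ω → ℝ) (x₀ : Ω → Fin n → ℝ) (k : ℕ) :
    MeasurableSpace Ω :=
  MeasurableSpace.comap x₀ inferInstance ⊔ ⨆ j, ⨆ _ : j < k,
    (MeasurableSpace.comap (w j) inferInstance ⊔ MeasurableSpace.comap (v j) inferInstance)

theorem measurable_past_init (w : ℕ → Ω → Fin n → ℝ) (v : ℕ → Ω → ℝ) (x₀ : Ω → Fin n → ℝ) (k : ℕ) :
    Measurable[past w v x₀ k] x₀ :=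
  measurable_iff_comap_le.2 le_sup_left

theorem measurable_past_noise (w : ℕ → Ω → Fin n → ℝ) (v : ℕ → Ω → ℝ) (x₀ : Ω → Fin n → ℝ)
    {j k : ℕ} (h : j < k) :
    Measurable[past w v x₀ k] (w j) ∧ Measurable[past w v x₀ k] (v j) := by
  have := le_iSup₂_of_le (f := fun j (_ : j < k) =>
    MeasurableSpace.comap (w j) inferInstance ⊔ MeasurableSpace.comap (v j) inferInstance) j h le_rfl
  exact ⟨measurable_iff_comap_le.2 ((le_sup_left.trans this).trans le_sup_right),
    measurable_iff_comap_le.2 ((le_sup_right.trans this).trans le_sup_right)⟩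

theorem measurable_trajectory {mΩ : MeasurableSpace Ω} {A A₁ : Matrix (Fin n) (Fin n) ℝ}
    {w : ℕ → Ω → Fin n → ℝ} {v : ℕ → Ω → ℝ} {x₀ : Ω → Fin n → ℝ} (hx₀ : Measurable x₀) {k : ℕ}
    (hw : ∀ j < k, Measurable (w j)) (hv : ∀ j < k, Measurable (v j)) :
    Measurable (trajectory A A₁ w v x₀ k) := by
  induction k with
  | zero => exact hx₀
  | succ k ih =>
    have h1 := ih (fun j hj => hw j (hj.trans k.lt_succ_self))
      fun j hj => hv j (hj.trans k.lt_succ_self)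
    have hm (C : Matrix (Fin n) (Fin n) ℝ) :
        Measurable fun ω => C *ᵥ trajectory A A₁ w v x₀ k ω :=
      (Continuous.matrix_mulVec continuous_const continuous_id).measurable.comp h1
    exact ((hm A).add ((hv k k.lt_succ_self).smul (hm A₁))).add (hw k k.lt_succ_self)

variable [MeasurableSpace Ω] {Pr : Measure Ω} {σ : ℝ}
  {Sig : Matrix (Fin n) (Fin n) ℝ} {w : ℕ → Ω → Fin n → ℝ} {v : ℕ → Ω → ℝ} {x₀ : Ω → Fin n → ℝ}

theorem indepFun_w_v (hnoise : IsNoise Pr σ Sig w v) (k : ℕ) : IndepFun (w k) (v k) Pr :=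
  hnoise.w_v_indep.comp (measurable_pi_apply k) (measurable_pi_apply k)

/-- A second admissible initial state under the same noise: subtracting the two moment recursions
cancels `Sig`. -/
theorem IsInitialState.two_smul (hx₀ : IsInitialState Pr w v x₀) :
    IsInitialState Pr w v (fun ω => (2 : ℝ) • x₀ ω) where
  measurable := hx₀.measurable.fun_const_smul 2
  memLp i := (hx₀.memLp i).const_mul 2
  cov_posDef := by
    have e : covMatrix Pr (fun ω => (2 : ℝ) • x₀ ω) = (4 : ℝ) • covMatrix Pr x₀ := by
      ext i j
      simp only [covMatrix, Matrix.of_apply, Matrix.smul_apply, Pi.smul_apply, smul_eq_mul,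
        covariance_const_mul_left, covariance_const_mul_right]
      ring
    rw [e]
    exact hx₀.cov_posDef.smul (by norm_num)
  indep := hx₀.indep.comp measurable_id (measurable_const_smul (2 : ℝ))

variable [IsProbabilityMeasure Pr]

/-- All `w j`, all `v j` and `x₀` are glued into one independent family; the past and the noise at
time `k` are generated by disjoint index sets. `S` omits exactly the two indices at time `k`. -/
theorem indep_past (hnoise : IsNoise Pr σ Sig w v) (hx₀ : IsInitialState Pr w v x₀) (k : ℕ) :
    Indep (past w v x₀ k) (MeasurableSpace.comap (fun ω => (w k ω, v k ω)) inferInstance) Pr := by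
  have hw : iIndep (fun k => MeasurableSpace.comap (w k) inferInstance) Pr := hnoise.w_indep.iIndep
  have hv : iIndep (fun k => MeasurableSpace.comap (v k) inferInstance) Pr := hnoise.v_indep.iIndep
  have hwv := iIndep_sumElim hw hv <| indep_of_indep_of_le hnoise.w_v_indep
    (iSup_le fun k => measurable_iff_comap_le.1
      ((measurable_pi_apply k).comp (comap_measurable (fun ω k => w k ω))))
    (iSup_le fun k => measurable_iff_comap_le.1
      ((measurable_pi_apply k).comp (comap_measurable (fun ω k => v k ω))))
  have hz (k : ℕ) : Measurable[MeasurableSpace.comap (fun ω k => (w k ω, v k ω)) inferInstance]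
      fun ω => (w k ω, v k ω) :=
    (measurable_pi_apply k).comp (comap_measurable fun ω k => (w k ω, v k ω))
  have hall := iIndep_sumElim hwv
    (m₂ := fun _ : Unit => MeasurableSpace.comap x₀ inferInstance) iIndep.of_subsingleton <| by
      refine indep_of_indep_of_le hx₀.indep (iSup_le ?_) (iSup_le fun _ => le_rfl)
      rintro (k | k)
      · exact measurable_iff_comap_le.1 (hz k).fst
      · exact measurable_iff_comap_le.1 (hz k).snd
  let S : Set ((ℕ ⊕ ℕ) ⊕ Unit) := {i | i ≠ Sum.inl (Sum.inl k) ∧ i ≠ Sum.inl (Sum.inr k)}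
  have hle : ∀ i, Sum.elim (Sum.elim (fun k => MeasurableSpace.comap (w k) inferInstance)
      fun k => MeasurableSpace.comap (v k) inferInstance)
      (fun _ : Unit => MeasurableSpace.comap x₀ inferInstance) i ≤ ‹MeasurableSpace Ω› := by
    rintro ((k | k) | k)
    · exact (hnoise.w_measurable k).comap_le
    · exact (hnoise.v_measurable k).comap_le
    · exact hx₀.measurable.comap_le
  have := indep_iSup_of_disjoint hle hall (disjoint_compl_right (a := S))
  have hS {i : (ℕ ⊕ ℕ) ⊕ Unit} (hi : i ∈ S) := le_iSup₂_of_le (f := fun i (_ : i ∈ S) =>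
    Sum.elim (Sum.elim (fun k => MeasurableSpace.comap (w k) inferInstance)
      fun k => MeasurableSpace.comap (v k) inferInstance)
      (fun _ : Unit => MeasurableSpace.comap x₀ inferInstance) i) i hi le_rfl
  have hS' {i : (ℕ ⊕ ℕ) ⊕ Unit} (hi : i ∈ Sᶜ) := le_iSup₂_of_le (f := fun i (_ : i ∈ Sᶜ) =>
    Sum.elim (Sum.elim (fun k => MeasurableSpace.comap (w k) inferInstance)
      fun k => MeasurableSpace.comap (v k) inferInstance)
      (fun _ : Unit => MeasurableSpace.comap x₀ inferInstance) i) i hi le_rfl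
  refine indep_of_indep_of_le this (sup_le (hS (i := Sum.inr ()) ?_)
    (iSup₂_le fun j hj => sup_le (hS (i := Sum.inl (Sum.inl j)) ?_)
      (hS (i := Sum.inl (Sum.inr j)) ?_))) ?_
  · simp [S]
  · simpa [S] using hj.ne
  · simpa [S] using hj.ne
  · refine measurable_iff_comap_le.1 (Measurable.prodMk ?_ ?_)
    · exact measurable_iff_comap_le.2 (hS' (i := Sum.inl (Sum.inl k)) (by simp [S]))
    · exact measurable_iff_comap_le.2 (hS' (i := Sum.inl (Sum.inr k)) (by simp [S]))

end Independence

/-! ### Second moment recursion -/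

section Moments

variable {Ω : Type u} [MeasurableSpace Ω] {Pr : Measure Ω} {n : ℕ}

theorem memLp_mulVec {x : Ω → Fin n → ℝ} (hx : ∀ i, MemLp (fun ω => x ω i) 2 Pr)
    (C : Matrix (Fin n) (Fin n) ℝ) (i : Fin n) : MemLp (fun ω => (C *ᵥ x ω) i) 2 Pr :=
  memLp_finsetSum Finset.univ fun j _ => (hx j).const_mul (C i j)

theorem secondMoment_mulVec_apply {x : Ω → Fin n → ℝ} (hx : ∀ i, MemLp (fun ω => x ω i) 2 Pr)
    (C D : Matrix (Fin n) (Fin n) ℝ) (i j : Fin n) :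
    ∫ ω, (C *ᵥ x ω) i * (D *ᵥ x ω) j ∂Pr = (C * secondMoment Pr x * Dᵀ) i j := by
  have hint : ∀ a b, Integrable (fun ω => x ω a * x ω b) Pr := fun a b =>
    (hx a).integrable_mul (hx b)
  have e : ∀ ω, (C *ᵥ x ω) i * (D *ᵥ x ω) j =
      ∑ b, ∑ a, C i a * D j b * (x ω a * x ω b) := by
    intro ω
    simp only [mulVec, dotProduct, Finset.sum_mul_sum]
    rw [Finset.sum_comm]
    exact Finset.sum_congr rfl fun b _ => Finset.sum_congr rfl fun a _ => by ring
  simp only [e]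
  rw [integral_finsetSum _ fun b _ => integrable_finsetSum _ fun a _ => (hint a b).const_mul _]
  simp only [Matrix.mul_apply, transpose_apply, secondMoment, Matrix.of_apply]
  refine Finset.sum_congr rfl fun b _ => ?_
  rw [integral_finsetSum _ fun a _ => (hint a b).const_mul _, Finset.sum_mul]
  refine Finset.sum_congr rfl fun a _ => ?_
  rw [integral_const_mul]
  ring

theorem trace_secondMoment {x : Ω → Fin n → ℝ} (hx : ∀ i, MemLp (fun ω => x ω i) 2 Pr) :
    (secondMoment Pr x).trace = ∫ ω, ∑ i, x ω i ^ 2 ∂Pr := by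
  rw [integral_finsetSum _ fun i _ => (hx i).integrable_sq]
  simp [Matrix.trace, secondMoment, sq]

/-- An output with vanishing second moment vanishes almost surely. -/
theorem sqrt_mulVec_ae_eq_zero {Q : Matrix (Fin n) (Fin n) ℝ} (hQ : 0 ≤ Q) {x : Ω → Fin n → ℝ}
    (hx : ∀ i, MemLp (fun ω => x ω i) 2 Pr) (h : (Q * secondMoment Pr x).trace = 0) :
    ∀ᵐ ω ∂Pr, CFC.sqrt Q *ᵥ x ω = 0 := by
  set C := CFC.sqrt Q with hC
  have hCt : Cᵀ = C := transpose_eq_of_nonneg (CFC.sqrt_nonneg Q)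
  have hCC : C * C = Q := CFC.sqrt_mul_sqrt_self Q hQ
  have hs : secondMoment Pr (fun ω => C *ᵥ x ω) = C * secondMoment Pr x * Cᵀ := by
    ext i j
    exact secondMoment_mulVec_apply hx C C i j
  have h1 := trace_secondMoment (memLp_mulVec hx C)
  rw [hs, hCt, Matrix.trace_mul_comm, ← Matrix.mul_assoc, hCC, h] at h1
  have h2 := (integral_eq_zero_iff_of_nonneg (fun ω => Finset.sum_nonneg fun i _ => sq_nonneg _)
    (integrable_finsetSum _ fun i _ => (memLp_mulVec hx C i).integrable_sq)).1 h1.symm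
  filter_upwards [h2] with ω hω
  funext i
  have := (Finset.sum_eq_zero_iff_of_nonneg fun i _ => sq_nonneg _).1 hω i (Finset.mem_univ i)
  exact pow_eq_zero_iff two_ne_zero |>.1 this

theorem integrable_mul_and_integral {β γ : Type*} [MeasurableSpace β] [MeasurableSpace γ]
    {X : Ω → β} {Y : Ω → γ} (h : IndepFun X Y Pr) {f : β → ℝ} {g : γ → ℝ} (hf : Measurable f)
    (hg : Measurable g) (hfX : Integrable (fun ω => f (X ω)) Pr)
    (hgY : Integrable (fun ω => g (Y ω)) Pr) :
    Integrable (fun ω => f (X ω) * g (Y ω)) Pr ∧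
      ∫ ω, f (X ω) * g (Y ω) ∂Pr = (∫ ω, f (X ω) ∂Pr) * ∫ ω, g (Y ω) ∂Pr := by
  have hi : IndepFun (fun ω => f (X ω)) (fun ω => g (Y ω)) Pr := h.comp hf hg
  exact ⟨hi.integrable_mul hfX hgY,
    hi.integral_fun_mul_eq_mul_integral hfX.aestronglyMeasurable hgY.aestronglyMeasurable⟩

variable [IsProbabilityMeasure Pr]

/-- One step of the second moment recursion. -/
theorem secondMoment_step {x w : Ω → Fin n → ℝ} {v : Ω → ℝ} {σ : ℝ}
    (hx : ∀ i, MemLp (fun ω => x ω i) 2 Pr) (hw : ∀ i, MemLp (fun ω => w ω i) 2 Pr)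
    (hv : MemLp v 2 Pr) (hxwv : IndepFun x (fun ω => (w ω, v ω)) Pr) (hwv : IndepFun w v Pr)
    (hw0 : ∀ i, ∫ ω, w ω i ∂Pr = 0) (hv0 : ∫ ω, v ω ∂Pr = 0) (hvσ : ∫ ω, v ω ^ 2 ∂Pr = σ)
    (A A₁ : Matrix (Fin n) (Fin n) ℝ) :
    (∀ i, MemLp (fun ω => (A *ᵥ x ω + v ω • (A₁ *ᵥ x ω) + w ω) i) 2 Pr) ∧
      secondMoment Pr (fun ω => A *ᵥ x ω + v ω • (A₁ *ᵥ x ω) + w ω) =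
        lyap 1 σ Aᵀ A₁ᵀ (secondMoment Pr x) + secondMoment Pr w := by
  have hmv (C : Matrix (Fin n) (Fin n) ℝ) (i : Fin n) : Measurable fun y : Fin n → ℝ => (C *ᵥ y) i :=
    ((continuous_apply i).comp (Continuous.matrix_mulVec continuous_const continuous_id)).measurable
  have hm1 : ∀ i, Measurable fun p : (Fin n → ℝ) × ℝ => p.1 i := fun i =>
    (measurable_pi_apply i).comp measurable_fst
  have hm2 : Measurable fun p : (Fin n → ℝ) × ℝ => p.2 := measurable_snd
  have hL1 (C : Matrix (Fin n) (Fin n) ℝ) (i : Fin n) : Integrable (fun ω => (C *ᵥ x ω) i) Pr :=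
    (memLp_mulVec hx C i).integrable one_le_two
  have hL2 (C D : Matrix (Fin n) (Fin n) ℝ) (i j : Fin n) :
      Integrable (fun ω => (C *ᵥ x ω) i * (D *ᵥ x ω) j) Pr :=
    (memLp_mulVec hx C i).integrable_mul (memLp_mulVec hx D j)
  have hvw (j : Fin n) : Integrable (fun ω => v ω * w ω j) Pr ∧ ∫ ω, v ω * w ω j ∂Pr = 0 := by
    have := integrable_mul_and_integral hwv.symm measurable_id (measurable_pi_apply j)
      (hv.integrable one_le_two) ((hw j).integrable one_le_two)
    refine ⟨this.1, this.2.trans ?_⟩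
    rw [hw0 j, mul_zero]
  have hvi := hv.integrable one_le_two
  have hwi := fun i => (hw i).integrable one_le_two
  have tV (C D : Matrix (Fin n) (Fin n) ℝ) (i j : Fin n) := integrable_mul_and_integral hxwv
    ((hmv C i).mul (hmv D j)) hm2 (hL2 C D i j) hvi
  have tVV (i j : Fin n) := integrable_mul_and_integral hxwv
    ((hmv A₁ i).mul (hmv A₁ j)) (hm2.pow_const 2) (hL2 A₁ A₁ i j) hv.integrable_sq
  have tW (i j : Fin n) := integrable_mul_and_integral hxwv (hmv A i) (hm1 j) (hL1 A i) (hwi j)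
  have tVW (i j : Fin n) := integrable_mul_and_integral hxwv (hmv A₁ i) (hm2.mul (hm1 j))
    (hL1 A₁ i) (hvw j).1
  simp only [hv0, hw0, hvσ, (hvw _).2, mul_zero, Pi.mul_apply] at tV tVV tW tVW
  refine ⟨fun i => ?_, ?_⟩
  · refine ((memLp_mulVec hx A i).add ?_).add (hw i)
    have hzv : AEStronglyMeasurable (fun ω => v ω • (A₁ *ᵥ x ω) i) Pr :=
      hv.aestronglyMeasurable.mul (memLp_mulVec hx A₁ i).aestronglyMeasurable
    refine (memLp_two_iff_integrable_sq hzv).2 ((tVV i i).1.congr (ae_of_all _ fun ω => ?_))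
    simp only [smul_eq_mul]
    ring
  · ext i j
    -- The last parenthesized group collects the cross terms; each integrates to zero by
    -- independence and zero means.
    have e : ∀ ω, (A *ᵥ x ω + v ω • (A₁ *ᵥ x ω) + w ω) i * (A *ᵥ x ω + v ω • (A₁ *ᵥ x ω) + w ω) j =
        (A *ᵥ x ω) i * (A *ᵥ x ω) j + (A₁ *ᵥ x ω) i * (A₁ *ᵥ x ω) j * v ω ^ 2 + w ω i * w ω j +
        ((A *ᵥ x ω) i * (A₁ *ᵥ x ω) j * v ω + (A₁ *ᵥ x ω) i * (A *ᵥ x ω) j * v ω +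
        ((A *ᵥ x ω) i * w ω j + (A *ᵥ x ω) j * w ω i) +
        ((A₁ *ᵥ x ω) i * (v ω * w ω j) + (A₁ *ᵥ x ω) j * (v ω * w ω i))) := by
      intro ω
      simp only [Pi.add_apply, Pi.smul_apply, smul_eq_mul]
      ring
    simp only [secondMoment, Matrix.of_apply, e]
    have hww : Integrable (fun ω => w ω i * w ω j) Pr := (hw i).integrable_mul (hw j)
    rw [integral_add (((hL2 A A i j).fun_add (tVV i j).1).fun_add hww)
      ((((tV A A₁ i j).1.fun_add (tV A₁ A i j).1).fun_add ((tW i j).1.fun_add (tW j i).1)).fun_add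
        ((tVW i j).1.fun_add (tVW j i).1)),
      integral_add ((hL2 A A i j).fun_add (tVV i j).1) hww, integral_add (hL2 A A i j) (tVV i j).1,
      integral_add (((tV A A₁ i j).1.fun_add (tV A₁ A i j).1).fun_add ((tW i j).1.fun_add (tW j i).1))
        ((tVW i j).1.fun_add (tVW j i).1),
      integral_add ((tV A A₁ i j).1.fun_add (tV A₁ A i j).1) ((tW i j).1.fun_add (tW j i).1),
      integral_add (tV A A₁ i j).1 (tV A₁ A i j).1, integral_add (tW i j).1 (tW j i).1,
      integral_add (tVW i j).1 (tVW j i).1, (tV A A₁ i j).2, (tV A₁ A i j).2, (tW i j).2,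
      (tW j i).2, (tVW i j).2, (tVW j i).2, (tVV i j).2, secondMoment_mulVec_apply hx,
      secondMoment_mulVec_apply hx]
    simp [lyap_apply, secondMoment, mul_comm]

/-- The second moment of an `L²` random vector dominates its covariance. -/
theorem secondMoment_posDef {x : Ω → Fin n → ℝ} (hx : ∀ i, MemLp (fun ω => x ω i) 2 Pr)
    (h : (covMatrix Pr x).PosDef) : (secondMoment Pr x).PosDef := by
  have e : secondMoment Pr x = covMatrix Pr x +
      vecMulVec (fun i => ∫ ω, x ω i ∂Pr) (fun i => ∫ ω, x ω i ∂Pr) := by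
    ext i j
    simp [secondMoment, covMatrix, vecMulVec_apply, covariance_eq_sub (hx i) (hx j)]
  rw [e]
  exact h.add_posSemidef (nonneg_iff_posSemidef.1 (vecMulVec_nonneg _))

theorem secondMoment_eq_covMatrix {x : Ω → Fin n → ℝ} (hx : ∀ i, MemLp (fun ω => x ω i) 2 Pr)
    (h0 : ∀ i, ∫ ω, x ω i ∂Pr = 0) : secondMoment Pr x = covMatrix Pr x := by
  ext i j
  simp [secondMoment, covMatrix, covariance_eq_sub (hx i) (hx j), h0]

theorem integral_v_sq {σ : ℝ} {Sig : Matrix (Fin n) (Fin n) ℝ} {w : ℕ → Ω → Fin n → ℝ}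
    {v : ℕ → Ω → ℝ} (hnoise : IsNoise Pr σ Sig w v) (k : ℕ) : ∫ ω, v k ω ^ 2 ∂Pr = σ := by
  rw [← hnoise.v_var k, variance_eq_sub (hnoise.v_memLp k), hnoise.v_mean k]
  simp

variable {σ : ℝ} {Sig : Matrix (Fin n) (Fin n) ℝ} {w : ℕ → Ω → Fin n → ℝ} {v : ℕ → Ω → ℝ}
  {x₀ : Ω → Fin n → ℝ}

/-- The state at time `k` is measurable with respect to the past, hence independent of the current
noise. Square integrability propagates by the same one-step lemma. -/
theorem secondMoment_trajectory_succ (hnoise : IsNoise Pr σ Sig w v)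
    (hx₀ : IsInitialState Pr w v x₀) (A A₁ : Matrix (Fin n) (Fin n) ℝ) (k : ℕ) :
    (∀ i, MemLp (fun ω => trajectory A A₁ w v x₀ k ω i) 2 Pr) ∧
      secondMoment Pr (trajectory A A₁ w v x₀ (k + 1)) =
        lyap 1 σ Aᵀ A₁ᵀ (secondMoment Pr (trajectory A A₁ w v x₀ k)) + Sig := by
  have hind (k : ℕ) : IndepFun (trajectory A A₁ w v x₀ k) (fun ω => (w k ω, v k ω)) Pr := by
    refine indep_of_indep_of_le_left (indep_past hnoise hx₀ k) (measurable_iff_comap_le.1 ?_)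
    exact measurable_trajectory (mΩ := past w v x₀ k) (measurable_past_init w v x₀ k)
      (fun j hj => (measurable_past_noise w v x₀ hj).1)
      fun j hj => (measurable_past_noise w v x₀ hj).2
  have hstep (k : ℕ) (h : ∀ i, MemLp (fun ω => trajectory A A₁ w v x₀ k ω i) 2 Pr) :=
    secondMoment_step h (hnoise.w_memLp k) (hnoise.v_memLp k) (hind k) (indepFun_w_v hnoise k)
      (hnoise.w_mean k) (hnoise.v_mean k) (integral_v_sq hnoise k) A A₁
  have hL : ∀ k, ∀ i, MemLp (fun ω => trajectory A A₁ w v x₀ k ω i) 2 Pr := by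
    intro k
    induction k with
    | zero => exact hx₀.memLp
    | succ k ih => exact (hstep k ih).1
  refine ⟨hL k, ?_⟩
  rw [← hnoise.w_cov k, ← secondMoment_eq_covMatrix (hnoise.w_memLp k) (hnoise.w_mean k)]
  exact (hstep k (hL k)).2

theorem secondMoment_homogeneous (hnoise : IsNoise Pr σ Sig w v)
    (hx₀ : IsInitialState Pr w v x₀) (A A₁ : Matrix (Fin n) (Fin n) ℝ) (ξ : Fin n → ℝ) (k : ℕ) :
    (∀ i, MemLp (fun ω => trajectory A A₁ (fun _ _ => 0) v (fun _ => ξ) k ω i) 2 Pr) ∧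
      secondMoment Pr (trajectory A A₁ (fun _ _ => 0) v (fun _ => ξ) k) =
        (lyap 1 σ Aᵀ A₁ᵀ)^[k] (vecMulVec ξ ξ) := by
  induction k with
  | zero =>
    refine ⟨fun i => memLp_const _, ?_⟩
    ext i j
    simp [secondMoment, trajectory, vecMulVec_apply]
  | succ k ih =>
    set x := trajectory A A₁ (fun _ _ => 0) v (fun _ => ξ) k with hx
    have hind : IndepFun x (fun ω => (w k ω, v k ω)) Pr := by
      refine indep_of_indep_of_le_left (indep_past hnoise hx₀ k) (measurable_iff_comap_le.1 ?_)
      exact measurable_trajectory (mΩ := past w v x₀ k) measurable_const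
        (fun j hj => measurable_const) fun j hj => (measurable_past_noise w v x₀ hj).2
    -- The one-step lemma is reused with zero additive noise.
    have hind' : IndepFun x (fun ω => ((0 : Fin n → ℝ), v k ω)) Pr :=
      hind.comp measurable_id (measurable_const.prodMk measurable_snd)
    have hstep := secondMoment_step (w := fun _ => 0) ih.1 (fun i => memLp_const _)
      (hnoise.v_memLp k) hind' (indepFun_const_left _ _) (by simp) (hnoise.v_mean k)
      (integral_v_sq hnoise k) A A₁
    refine ⟨hstep.1, ?_⟩
    rw [Function.iterate_succ_apply', ← ih.2]
    refine hstep.2.trans (add_eq_left.2 ?_)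
    ext i j
    simp [secondMoment]

theorem isMomentDetectable (hnoise : IsNoise Pr σ Sig w v) (hx₀ : IsInitialState Pr w v x₀)
    {A A₁ Q : Matrix (Fin n) (Fin n) ℝ} (hQ : 0 ≤ Q)
    (hdet : IsExactlyDetectable Pr v A A₁ (CFC.sqrt Q)) : IsMomentDetectable σ A A₁ Q := by
  intro ξ h
  have hm := secondMoment_homogeneous hnoise hx₀ A A₁ ξ
  refine (hdet ξ fun k => sqrt_mulVec_ae_eq_zero hQ (hm k).1 ?_).congr fun k => ?_
  · rw [(hm k).2, h k]
  · rw [← (hm k).2, trace_secondMoment (hm k).1]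

/-- Mean square stability forces the homogeneous second moment recursion to decay. -/
theorem tendsto_of_isMeanSquareStable (hnoise : IsNoise Pr σ Sig w v)
    (hx₀ : IsInitialState Pr w v x₀) {G H : Matrix (Fin n) (Fin n) ℝ}
    (hst : IsMeanSquareStable.{u} σ Sig G H) :
    Tendsto (fun k => ((lyap 1 σ Gᵀ Hᵀ)^[k] (secondMoment Pr x₀)).trace) atTop (𝓝 0) := by
  obtain ⟨_, X, hX⟩ := hst Ω Pr w v hnoise
  have h1 := (hX x₀ hx₀).2
  have h2 := (hX _ hx₀.two_smul).2
  -- Doubling the initial state multiplies its second moment by `4`, and `4 - 1 = 3`. Both moment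
  -- sequences share one limit, so the difference tends to zero.
  have e : ∀ k, secondMoment Pr (trajectory G H w v (fun ω => (2 : ℝ) • x₀ ω) k) -
      secondMoment Pr (trajectory G H w v x₀ k) =
        (3 : ℝ) • (lyap 1 σ Gᵀ Hᵀ)^[k] (secondMoment Pr x₀) := by
    intro k
    induction k with
    | zero =>
      ext i j
      have (ω : Ω) : 2 * x₀ ω i * (2 * x₀ ω j) = 4 * (x₀ ω i * x₀ ω j) := by ring
      simp only [secondMoment, trajectory, Matrix.sub_apply, Matrix.of_apply, Matrix.smul_apply,
        Pi.smul_apply, smul_eq_mul, Function.iterate_zero, id_eq, this, integral_const_mul]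
      ring
    | succ k ih =>
      rw [(secondMoment_trajectory_succ hnoise hx₀ G H k).2,
        (secondMoment_trajectory_succ hnoise hx₀.two_smul G H k).2, add_sub_add_right_eq_sub,
        ← map_sub, ih, map_smul, Function.iterate_succ_apply']
  have h3 := (h2.sub h1).const_smul (3⁻¹ : ℝ)
  simp only [e, sub_self, smul_zero, smul_smul] at h3
  norm_num at h3
  have hc : Continuous fun M : Matrix (Fin n) (Fin n) ℝ => M.trace := by fun_prop
  have := (hc.tendsto 0).comp h3
  rwa [trace_zero] at this

end Moments
end StochLQR

/-! ### Main theorem -/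

theorem theorem2 {n m : ℕ} (α σ : ℝ) (hα₀ : 0 < α) (hα₁ : α < 1)
    (A A₁ : Matrix (Fin n) (Fin n) ℝ) (B B₁ : Matrix (Fin n) (Fin m) ℝ)
    (Q : Matrix (Fin n) (Fin n) ℝ) (hQ : Q.PosSemidef)
    (R : Matrix (Fin m) (Fin m) ℝ) (hR : R.PosDef)
    {Ω : Type u} [MeasurableSpace Ω] (Pr : Measure Ω) [IsProbabilityMeasure Pr]
    (Sig : Matrix (Fin n) (Fin n) ℝ) (w : ℕ → Ω → Fin n → ℝ) (v : ℕ → Ω → ℝ)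
    (hnoise : StochLQR.IsNoise Pr σ Sig w v)
    (x₀ : Ω → Fin n → ℝ) (hx₀ : StochLQR.IsInitialState Pr w v x₀)
    (hstab : ∃ L : Matrix (Fin m) (Fin n) ℝ, StochLQR.IsStabilizingGain.{u} σ Sig A A₁ B B₁ L)
    (hdet : StochLQR.IsExactlyDetectable Pr v A A₁ (CFC.sqrt Q)) :
    ∃ P : Matrix (Fin n) (Fin n) ℝ,
      (StochLQR.IsRiccatiSolution α σ A A₁ B B₁ Q R P ∧
        ∀ P', StochLQR.IsRiccatiSolution α σ A A₁ B B₁ Q R P' → P' = P) ∧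
      StochLQR.IsDualOptimal α σ A A₁ B B₁ Q R
        (StochLQR.secondMoment Pr x₀ + (α / (1 - α)) • Sig)
        (StochLQR.qParam α σ A A₁ B B₁ Q R P) P ∧
      (∀ F M, StochLQR.IsDualOptimal α σ A A₁ B B₁ Q R
          (StochLQR.secondMoment Pr x₀ + (α / (1 - α)) • Sig) F M →
        M = P ∧ (StochLQR.qParam α σ A A₁ B B₁ Q R P - F).PosSemidef ∧
          F.toBlocks₂₂⁻¹ * F.toBlocks₁₂ᵀ =
            (StochLQR.qParam α σ A A₁ B B₁ Q R P).toBlocks₂₂⁻¹ *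
              (StochLQR.qParam α σ A A₁ B B₁ Q R P).toBlocks₁₂ᵀ) ∧
      (∀ X : Matrix (Fin n) (Fin n) ℝ, X.PosDef → ∀ F M,
        (StochLQR.IsDualOptimal α σ A A₁ B B₁ Q R X F M ↔
          StochLQR.IsDualOptimal α σ A A₁ B B₁ Q R
            (StochLQR.secondMoment Pr x₀ + (α / (1 - α)) • Sig) F M)) := by

  have hα₀' := hα₀.le
  have hα₁' := hα₁.le
  have hσ := hnoise.σ_pos.le
  have hQ' := nonneg_iff_posSemidef.2 hQ
  have hX₀ := StochLQR.secondMoment_posDef hx₀.memLp hx₀.cov_posDef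
  -- Positive definiteness is all that the characterization of optimal points needs from the weight,
  -- whence independence of `X`.
  have hW : (StochLQR.secondMoment Pr x₀ + (α / (1 - α)) • Sig).PosDef :=
    hX₀.add_posSemidef (hnoise.Sig_posDef.posSemidef.smul (div_nonneg hα₀' (sub_nonneg.2 hα₁')))
  have hd := StochLQR.isMomentDetectable hnoise hx₀ hQ' hdet
  obtain ⟨L, hL⟩ := hstab
  obtain ⟨Y, hY, hYs⟩ := StochLQR.exists_lyap_of_tendsto hα₀' hα₁' hσ hX₀
    (StochLQR.tendsto_of_isMeanSquareStable hnoise hx₀ hL)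
  obtain ⟨P, hP⟩ := StochLQR.exists_isRiccatiSolution hα₀' hσ hQ' hR hY hYs
  have hiff {X : Matrix (Fin n) (Fin n) ℝ} (hX : X.PosDef)
      (F : Matrix (Fin n ⊕ Fin m) (Fin n ⊕ Fin m) ℝ) (M : Matrix (Fin n) (Fin n) ℝ) :=
    StochLQR.isDualOptimal_iff (F := F) (M := M) hα₀' hα₁' hσ hQ' hR hd hP hX
  refine ⟨P, ⟨hP, fun P' hP' => StochLQR.isRiccatiSolution_unique hα₀' hα₁' hσ hQ' hR hd hP hP'⟩,
    (hiff hW _ _).2 ⟨StochLQR.isDualFeasible_qParam hα₀' hσ hQ' hR hP, rfl⟩, fun F M hFM => ?_,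
    fun X hX F M => (hiff hX F M).trans (hiff hW F M).symm⟩
  obtain ⟨hF, rfl⟩ := (hiff hW F M).1 hFM
  obtain ⟨hle, hgain⟩ := hF.of_eq_solution hα₀' hα₁' hσ hQ' hR hd hP
  exact ⟨rfl, hle, neg_injective hgain⟩
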